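/- **Setting.** Let $V$ be a finite set, let $I_\gamma$ ($\gamma\in V$) be finite sets of levels, $\mathcal I=\prod_{\gamma\in V} I_\gamma$, and fix a base cell $i^*\in\mathcal I$. For $E\subseteq V$ put $\mathcal I_E=\prod_{\gamma\in E}I_\gamma$ and $\mathcal I_E^*=\{i_E\in\mathcal I_E : i_\gamma\ne i^*_\gamma\ \forall \gamma\in E\}$. Let $G$ be a decomposable graph on $V$, that is, its cliques (maximal complete sets) have a perfect ordering: they can be listed without repetition as $C_1,\dots,C_k$ so that for each $l\ge2$ the separator $S_l=C_l\cap(C_1\cup\dots\cup C_{l-1})$ is contained in some $C_j$ with $j<l$. Fix such an ordering. Let $\mathcal D$ be the set of nonempty complete subsets of $V$ and, for $T\subseteq V$, let $\mathcal D^{T}$ be the set of nonempty subsets of $T$. For $\theta=(\theta_D(i_D))_{D\in\mathcal D,\,i_D\in\mathcal I_D^*}$ let $$Z(\theta)=1+\sum_{i\ne i^*}\exp\sum_{D\in\mathcal D^*_i}\theta_D(i_D),\qquad p(i)=Z(\theta)^{-1}\exp\sum_{D\in\mathcal D_i^*}\theta_D(i_D),$$ where $\mathcal D_i^*=\{D\in\mathcal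 D: i_\gamma\neq i^*_\gamma\ \forall\gamma\in D\}$. For $\alpha>0$ and $s=(s(i_D))_{D\in\mathcal D,\,i_D\in\mathcal I_D^*}$ real, put $$I_G(s,\alpha)=\int \exp\Big\{\sum_{D\in\mathcal D}\sum_{i_D\in\mathcal I_D^*}\theta_D(i_D)s(i_D)-\alpha\log Z(\theta)\Big\}\,d\theta .$$ Assume that the prior is proper, i.e. $I_G(s,\alpha)<\infty$, and let $\pi_G(\theta\mid s,\alpha)$ be the probability density given by the integrand divided by $I_G(s,\alpha)$. For $T\in\{C_1,\dots,C_k,S_2,\dots,S_k\}$, $D\in\mathcal D^T$ and $i_D\in\mathcal I_D^*$ let $$\alpha^{T}(i_D,i^*_{T\setminus D})=\sum_{D\subseteq F\subseteq T}\ \sum_{j_F\in\mathcal I_F^*:\,(j_F)_D=i_D}(-1)^{|F\setminus D|}s(j_F),\qquad \alpha^{T}_\emptyset=\alpha+\sum_{\emptyset\ne D\subseteq T}(-1)^{|D|}\sum_{i_D\in\mathcal I_D^*}s(i_D).$$ For a table $p$ of probabilities, $p^T$ denotes its marginal table on $T$, and $p^T_\emptyset=p^T(i^*_T)$. Free marginal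 probabilities $p^G$ are a family indexed by the pairs $(D,i_D)$, $D\in\mathcal D$, $i_D\in\mathcal I^*_D$: the entry at $(D,i_D)$ is $p^{S_l}(i_D,i^*_{S_l\setminus D})$ for one chosen separator $S_l\supseteq D$ if there is one, and $p^{C_l}(i_D,i^*_{C_l\setminus D})$ for the clique $C_l\supseteq D$ otherwise. The hyper Dirichlet law with parameter tables $\alpha^{C_l},\alpha^{S_l}$ is the measure carried by the positive probability tables $p$ that are Markov with respect to $G$ (those with $p(i)=\prod_{l=1}^k p^{C_l}(i_{C_l})/\prod_{l=2}^k p^{S_l}(i_{S_l})$) whose density with respect to Lebesgue measure $dp^G$ is $$\frac{\prod_{l=1}^k \mathrm{Dir}_{C_l}(p^{C_l};\alpha^{C_l})}{\prod_{l=2}^k \mathrm{Dir}_{S_l}(p^{S_l};\alpha^{S_l})},$$ $$\mathrm{Dir}_T(p^T;\alpha^T)=\frac{\Gamma\big(\alpha^T_\emptyset+\sum_{D\in\mathcal D^T}\sum_{i_D\in\mathcal I_D^*}\alpha^T(i_D,i^*_{T\setminus D})\big)}{\Gamma(\alpha^T_\emptyset)\prod_{D\in\mathcal D^T,\,i_D\in\mathcal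 I_D^*}\Gamma(\alpha^T(i_D,i^*_{T\setminus D}))}\,(p^T_\emptyset)^{\alpha^T_\emptyset-1}\prod_{D\in\mathcal D^T,\,i_D\in\mathcal I_D^*}p^T(i_D,i^*_{T\setminus D})^{\alpha^T(i_D,i^*_{T\setminus D})-1}.$$ **Proposition.** The numbers $\alpha^{C_l}_\emptyset,\alpha^{C_l}(i_D,i^*_{C_l\setminus D}),\alpha^{S_l}_\emptyset,\alpha^{S_l}(i_D,i^*_{S_l\setminus D})$ are all positive, and they are hyperconsistent: the tables $\alpha^{C_l}$ and $\alpha^{C_m}$ have the same marginal on $C_l\cap C_m$, and the marginal of $\alpha^{C_l}$ on $S_l$ is $\alpha^{S_l}$. For every choice of free marginal probabilities $p^G$, the law of the cell probabilities $p=(p(i))_{i\in\mathcal I}$ when $\theta$ has density $\pi_G(\theta\mid s,\alpha)$ is the hyper Dirichlet law with these hyperparameters. Moreover $$I_G(s,\alpha)=\frac{\prod_{l=1}^k\Gamma(\alpha_\emptyset^{C_l})\prod_{D\in\mathcal D^{C_l}}\prod_{i_D\in\mathcal I_D^*}\Gamma(\alpha^{C_l}(i_D,i^*_{C_l\setminus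 D}))}{\Gamma(\alpha)\ \prod_{l=2}^k\Gamma(\alpha_\emptyset^{S_l})\prod_{D\in\mathcal D^{S_l}}\prod_{i_D\in\mathcal I_D^*}\Gamma(\alpha^{S_l}(i_D,i^*_{S_l\setminus D}))}.$$ -/

import Mathlib

open MeasureTheory

namespace LogLinear

section Cells

variable {V : Type*} [Fintype V] [DecidableEq V] {I : V → Type*}

/-- The cell `(i_E, i*_{Eᶜ})`: it agrees with `i` on `E` and with the base cell `o = i*` off `E`. -/
def restr (o : ∀ γ, I γ) (E : Finset V) (i : ∀ γ, I γ) : ∀ γ, I γ :=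
  fun γ => if γ ∈ E then i γ else o γ

variable [∀ γ, DecidableEq (I γ)]

/-- The set of factors at which the cell `i` is not at the base level. A pair `(D, i_D)` with
`i_D ∈ I*_D` (all levels different from the base level) is encoded throughout as the cell
`(i_D, i*_{Dᶜ})`; `D` is then recovered as the support of that cell. -/
def supp (o i : ∀ γ, I γ) : Finset V := Finset.univ.filter fun γ => i γ ≠ o γ

variable [∀ γ, Fintype (I γ)]

/-- The set `I*_D`, each `i_D` being encoded as the cell `(i_D, i*_{Dᶜ})`. -/
def starCells (o : ∀ γ, I γ) (D : Finset V) : Finset (∀ γ, I γ) :=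
  Finset.univ.filter fun i => supp o i = D

/-- The cells of the `T`-marginal table, `i_T` being encoded as `(i_T, i*_{Tᶜ})`. -/
def tableCells (o : ∀ γ, I γ) (T : Finset V) : Finset (∀ γ, I γ) :=
  Finset.univ.filter fun i => supp o i ⊆ T

/-- The marginal table `f^T(c_T) = ∑_{j : j_T = c_T} f(j)` of a function `f` on cells. -/
def marg (T : Finset V) (f : (∀ γ, I γ) → ℝ) (c : ∀ γ, I γ) : ℝ :=
  ∑ j ∈ Finset.univ.filter (fun j : ∀ γ, I γ => ∀ γ ∈ T, j γ = c γ), f j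

end Cells

section Cliques

variable {V : Type*} [Fintype V] [DecidableEq V]

/-- `S_l = C_l ∩ (C_1 ∪ ⋯ ∪ C_{l-1})`, of interest for every `l` but the first. -/
def separator {k : ℕ} (C : Fin k → Finset V) (l : Fin k) : Finset V :=
  C l ∩ (Finset.univ.filter fun j => j < l).biUnion C

/-- The indices of all cliques but the first. -/
def sepIdx (k : ℕ) : Finset (Fin k) := Finset.univ.filter fun l => 0 < l.val

/-- `C_1, …, C_k` is a perfect ordering of the cliques (maximal complete subsets) of `G`: each
clique is listed exactly once, and the running intersection property holds. A graph is decomposable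
when its cliques have a perfect ordering. -/
structure IsPerfectOrdering (G : SimpleGraph V) {k : ℕ} (C : Fin k → Finset V) : Prop where
  injective : Function.Injective C
  range_eq : ∀ A : Finset V,
    (∃ l, C l = A) ↔ Maximal (fun B : Finset V => G.IsClique (B : Set V)) A
  running_intersection : ∀ l ∈ sepIdx k, ∃ j < l, separator C l ⊆ C j

end Cliques

section Prior

variable {V : Type*} [Fintype V] [DecidableEq V] {I : V → Type*} [∀ γ, Fintype (I γ)]
  [∀ γ, DecidableEq (I γ)]

/-- The family `𝒟` of nonempty complete subsets of `V`. -/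
def IsInteraction (G : SimpleGraph V) (D : Finset V) : Prop := D.Nonempty ∧ G.IsClique (D : Set V)

instance (G : SimpleGraph V) [DecidableRel G.Adj] (D : Finset V) : Decidable (IsInteraction G D) :=
  inferInstanceAs (Decidable (_ ∧ _))

/-- The index set of all pairs `(D, i_D)` with `D ∈ 𝒟` and `i_D ∈ I*_D`. -/
abbrev Idx (G : SimpleGraph V) (o : ∀ γ, I γ) : Type _ :=
  {i : ∀ γ, I γ // IsInteraction G (supp o i)}

variable (G : SimpleGraph V) [DecidableRel G.Adj] (o : ∀ γ, I γ)

/-- The value `x_D(i_D)` of a family `x` indexed by `Idx G o`, as a function of the cell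
`(i_D, i*_{Dᶜ})`. -/
def val (x : Idx G o → ℝ) (i : ∀ γ, I γ) : ℝ :=
  if h : IsInteraction G (supp o i) then x ⟨i, h⟩ else 0

/-- `∑_{D ∈ 𝒟*_i} θ_D(i_D)`, over the `D ∈ 𝒟` such that `i_γ` is not the base level for any
`γ ∈ D`. -/
def logOdds (θ : Idx G o → ℝ) (i : ∀ γ, I γ) : ℝ :=
  ∑ D ∈ (supp o i).powerset.filter (IsInteraction G), val G o θ (restr o D i)

/-- `1 + ∑_{i ≠ i*} exp ∑_{D ∈ 𝒟*_i} θ_D(i_D)`. -/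
noncomputable def partitionFn (θ : Idx G o → ℝ) : ℝ :=
  1 + ∑ i ∈ Finset.univ.erase o, Real.exp (logOdds G o θ i)

/-- The table of cell probabilities `p(i)` with log-linear parameter `θ`. -/
noncomputable def cellProb (θ : Idx G o → ℝ) (i : ∀ γ, I γ) : ℝ :=
  Real.exp (logOdds G o θ i) / partitionFn G o θ

/-- The unnormalised conjugate prior density on the log-linear parameter. -/
noncomputable def priorKernel (s : Idx G o → ℝ) (α : ℝ) (θ : Idx G o → ℝ) : ℝ :=
  Real.exp (∑ j, θ j * s j - α * Real.log (partitionFn G o θ))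

/-- The normalising constant `I_G(s, α)`. -/
noncomputable def normConst (s : Idx G o → ℝ) (α : ℝ) : ℝ := ∫ θ, priorKernel G o s α θ

/-- The conjugate prior: the measure with density `π_G(θ | s, α)` with respect to Lebesgue
measure. -/
noncomputable def prior (s : Idx G o → ℝ) (α : ℝ) : Measure (Idx G o → ℝ) :=
  volume.withDensity fun θ => ENNReal.ofReal ((normConst G o s α)⁻¹ * priorKernel G o s α θ)

/-- The hyperparameters `α^T(i_D, i*_{T \ D})` and `α^T_∅` for a complete set `T`, at the cell
`i = (i_D, i*_{Dᶜ})` with `D ⊆ T`. -/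
noncomputable def hyperParam (s : Idx G o → ℝ) (α : ℝ) (T : Finset V) (i : ∀ γ, I γ) : ℝ :=
  if i = o then
    α + ∑ D ∈ T.powerset.filter Finset.Nonempty,
      (-1 : ℝ) ^ D.card * ∑ j ∈ starCells o D, val G o s j
  else
    ∑ F ∈ T.powerset.filter (fun F => supp o i ⊆ F),
      ∑ j ∈ (starCells o F).filter (fun j => restr o (supp o i) j = i),
        (-1 : ℝ) ^ (F \ supp o i).card * val G o s j

end Prior

section HyperDirichlet

variable {V : Type*} [Fintype V] [DecidableEq V] {I : V → Type*} [∀ γ, Fintype (I γ)]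
  [∀ γ, DecidableEq (I γ)]

/-- The Dirichlet density on the `T`-marginal table, with parameter table `a`, at the table `x`. -/
noncomputable def dirichletDensity (o : ∀ γ, I γ) (T : Finset V) (a x : (∀ γ, I γ) → ℝ) : ℝ :=
  Real.Gamma (∑ c ∈ tableCells o T, a c) / (∏ c ∈ tableCells o T, Real.Gamma (a c)) *
    ∏ c ∈ tableCells o T, x c ^ (a c - 1)

/-- The hyper Dirichlet density at the table `p`: Dirichlet densities of the clique marginals over
those of the separator marginals. Here `a T` is the parameter table of the Dirichlet on `T`. -/
noncomputable def hyperDirichletDensity (o : ∀ γ, I γ) {k : ℕ} (C : Fin k → Finset V)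
    (a : Finset V → (∀ γ, I γ) → ℝ) (p : (∀ γ, I γ) → ℝ) : ℝ :=
  (∏ l, dirichletDensity o (C l) (a (C l)) (marg (C l) p)) /
    ∏ l ∈ sepIdx k, dirichletDensity o (separator C l) (a (separator C l)) (marg (separator C l) p)

/-- The positive probability tables that are Markov with respect to the decomposable graph with
perfectly ordered cliques `C`: `p(i) = ∏ p^{C_l}(i_{C_l}) / ∏ p^{S_l}(i_{S_l})`. -/
def markovTables {k : ℕ} (C : Fin k → Finset V) : Set ((∀ γ, I γ) → ℝ) :=
  {p | (∀ i, 0 < p i) ∧ ∑ i, p i = 1 ∧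
    ∀ i, p i = (∏ l, marg (C l) p i) / ∏ l ∈ sepIdx k, marg (separator C l) p i}

/-- A choice of free marginal probabilities: for every `D ∈ 𝒟`, `i_D ∈ I*_D`, the table `R` in which
`p^R(i_D, i*_{R \ D})` is read. It is the table of a separator containing `D` if there is one (there
can be several), and otherwise that of the clique containing `D`. -/
def IsFreeChoice (G : SimpleGraph V) (o : ∀ γ, I γ) {k : ℕ} (C : Fin k → Finset V)
    (R : Idx G o → Finset V) : Prop :=
  ∀ j : Idx G o, supp o j.1 ⊆ R j ∧
    ((∃ l ∈ sepIdx k, R j = separator C l) ∨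
      ((∀ l ∈ sepIdx k, ¬ supp o j.1 ⊆ separator C l) ∧ ∃ l, R j = C l))

/-- The free marginal probabilities `p^G` of a table `p`. -/
def freeMarginals (G : SimpleGraph V) (o : ∀ γ, I γ) (R : Idx G o → Finset V)
    (p : (∀ γ, I γ) → ℝ) : Idx G o → ℝ :=
  fun j => marg (R j) p j.1

/-- The hyper Dirichlet law, as a measure on tables: it is carried by the Markov tables, and
has the hyper Dirichlet density with respect to Lebesgue measure `dp^G` in the free marginal
probabilities. -/
noncomputable def hyperDirichlet (G : SimpleGraph V) [DecidableRel G.Adj] (o : ∀ γ, I γ) {k : ℕ}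
    (C : Fin k → Finset V) (R : Idx G o → Finset V) (a : Finset V → (∀ γ, I γ) → ℝ) :
    Measure ((∀ γ, I γ) → ℝ) :=
  (((volume : Measure (Idx G o → ℝ)).comap
      fun p : markovTables (I := I) C => freeMarginals G o R p.1).withDensity
    fun p => ENNReal.ofReal (hyperDirichletDensity o C a p.1)).map Subtype.val

/-- Hyperconsistency of the parameter tables: those of two cliques have the same marginal on the
intersection, and that of a separator `S_l` is the marginal of that of `C_l`. -/
def IsHyperconsistent (o : ∀ γ, I γ) {k : ℕ} (C : Fin k → Finset V)
    (a : Finset V → (∀ γ, I γ) → ℝ) : Prop :=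
  (∀ l m, ∀ c ∈ tableCells o (C l ∩ C m),
    ∑ i ∈ (tableCells o (C l)).filter (fun i => restr o (C l ∩ C m) i = c), a (C l) i =
      ∑ i ∈ (tableCells o (C m)).filter (fun i => restr o (C l ∩ C m) i = c), a (C m) i) ∧
  ∀ l ∈ sepIdx k, ∀ c ∈ tableCells o (separator C l),
    ∑ i ∈ (tableCells o (C l)).filter (fun i => restr o (separator C l) i = c), a (C l) i =
      a (separator C l) c

end HyperDirichlet

end LogLinear

namespace LogLinear

section Moebius

variable {V : Type*} [DecidableEq V] {I : V → Type*} [∀ γ, DecidableEq (I γ)]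

/-- `c = j_D` for some set `D` of factors, `j_D` being encoded as the cell `(j_D, i*_{Dᶜ})`. -/
def Below (o c j : ∀ γ, I γ) : Prop := ∀ γ, c γ = o γ ∨ c γ = j γ

instance [Fintype V] (o c j : ∀ γ, I γ) : Decidable (Below o c j) :=
  inferInstanceAs (Decidable (∀ γ, c γ = o γ ∨ c γ = j γ))

/-- Switches the level of the cell `c` at `γ` between the base level and that of `x`. -/
def toggle (o x : ∀ γ, I γ) (γ : V) (c : ∀ γ, I γ) : ∀ γ, I γ :=
  Function.update c γ (if c γ = o γ then x γ else o γ)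

variable {o : ∀ γ, I γ}

omit [DecidableEq V] [∀ γ, DecidableEq (I γ)] in
theorem Below.refl (c : ∀ γ, I γ) : Below o c c := fun _ => Or.inr rfl

omit [DecidableEq V] [∀ γ, DecidableEq (I γ)] in
theorem Below.trans {c j x : ∀ γ, I γ} (h : Below o c j) (h' : Below o j x) : Below o c x := by
  intro γ
  rcases h γ with h1 | h1
  · exact Or.inl h1
  · rcases h' γ with h2 | h2
    · exact Or.inl (h1.trans h2)
    · exact Or.inr (h1.trans h2)

omit [DecidableEq V] [∀ γ, DecidableEq (I γ)] in
theorem below_base (c : ∀ γ, I γ) : Below o o c := fun _ => Or.inl rfl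

variable [Fintype V]

omit [DecidableEq V] in
@[simp] theorem mem_supp {i : ∀ γ, I γ} {γ : V} : γ ∈ supp o i ↔ i γ ≠ o γ := by simp [supp]

omit [DecidableEq V] in
theorem supp_eq_empty {i : ∀ γ, I γ} : supp o i = ∅ ↔ i = o := by
  constructor
  · intro h
    funext γ
    by_contra hne
    have : γ ∈ supp o i := mem_supp.2 hne
    simp [h] at this
  · rintro rfl
    ext γ
    simp

omit [DecidableEq V] in
@[simp] theorem supp_base : supp o o = ∅ := supp_eq_empty.2 rfl

omit [DecidableEq V] in
theorem Below.supp_subset {c j : ∀ γ, I γ} (h : Below o c j) : supp o c ⊆ supp o j := by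
  intro γ hγ
  rw [mem_supp] at hγ ⊢
  rcases h γ with h1 | h1
  · exact absurd h1 hγ
  · rwa [← h1]

omit [DecidableEq V] in
theorem Below.eq_of_card_le {c j : ∀ γ, I γ} (h : Below o c j)
    (hc : (supp o j).card ≤ (supp o c).card) : c = j := by
  have hs := Finset.eq_of_subset_of_card_le h.supp_subset hc
  funext γ
  rcases h γ with h1 | h1
  · have : γ ∉ supp o j := by rw [← hs, mem_supp]; simpa using h1
    simp only [mem_supp, not_not] at this
    rw [h1, this]
  · exact h1

omit [Fintype V] [∀ γ, DecidableEq (I γ)] in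
theorem restr_apply_of_mem {E : Finset V} {γ : V} (h : γ ∈ E) (i : ∀ γ, I γ) :
    restr o E i γ = i γ := if_pos h

omit [Fintype V] [∀ γ, DecidableEq (I γ)] in
theorem restr_apply_of_notMem {E : Finset V} {γ : V} (h : γ ∉ E) (i : ∀ γ, I γ) :
    restr o E i γ = o γ := if_neg h

omit [Fintype V] [∀ γ, DecidableEq (I γ)] in
theorem restr_congr {E : Finset V} {i j : ∀ γ, I γ} (h : ∀ γ ∈ E, i γ = j γ) :
    restr o E i = restr o E j := by
  funext γ
  by_cases hγ : γ ∈ E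
  · rw [restr_apply_of_mem hγ, restr_apply_of_mem hγ, h γ hγ]
  · rw [restr_apply_of_notMem hγ, restr_apply_of_notMem hγ]

omit [Fintype V] [∀ γ, DecidableEq (I γ)] in
theorem restr_eq_restr {E : Finset V} {i j : ∀ γ, I γ} :
    restr o E i = restr o E j ↔ ∀ γ ∈ E, i γ = j γ := by
  refine ⟨fun h γ hγ => ?_, restr_congr⟩
  rw [← restr_apply_of_mem (o := o) hγ i, h, restr_apply_of_mem hγ]

omit [Fintype V] [∀ γ, DecidableEq (I γ)] in
theorem restr_below (E : Finset V) (i : ∀ γ, I γ) : Below o (restr o E i) i := by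
  intro γ
  by_cases h : γ ∈ E
  · exact Or.inr (restr_apply_of_mem h i)
  · exact Or.inl (restr_apply_of_notMem h i)

theorem supp_restr (E : Finset V) (i : ∀ γ, I γ) : supp o (restr o E i) = E ∩ supp o i := by
  ext γ
  by_cases h : γ ∈ E
  · simp [h, restr_apply_of_mem h]
  · simp [h, restr_apply_of_notMem h]

omit [Fintype V] [∀ γ, DecidableEq (I γ)] in
theorem restr_restr (E F : Finset V) (i : ∀ γ, I γ) :
    restr o E (restr o F i) = restr o (E ∩ F) i := by
  funext γ
  simp only [restr, Finset.mem_inter]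
  split_ifs <;> simp_all

theorem restr_eq_self {E : Finset V} {i : ∀ γ, I γ} : restr o E i = i ↔ supp o i ⊆ E := by
  constructor
  · intro h
    rw [← h, supp_restr]
    exact Finset.inter_subset_left
  · intro h
    funext γ
    by_cases hγ : γ ∈ E
    · exact restr_apply_of_mem hγ i
    · rw [restr_apply_of_notMem hγ]
      by_contra hne
      exact hγ (h (mem_supp.2 (Ne.symm hne)))

theorem below_iff_restr {c j : ∀ γ, I γ} : Below o c j ↔ restr o (supp o c) j = c := by
  constructor
  · intro h
    funext γ
    by_cases hγ : γ ∈ supp o c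
    · rw [restr_apply_of_mem hγ]
      exact ((h γ).resolve_left (mem_supp.1 hγ)).symm
    · rw [restr_apply_of_notMem hγ]
      exact (not_not.1 (mem_supp.not.1 hγ)).symm
  · intro h
    rw [← h]
    exact restr_below _ _

variable [∀ γ, Fintype (I γ)]

@[simp] theorem mem_tableCells {T : Finset V} {c : ∀ γ, I γ} :
    c ∈ tableCells o T ↔ supp o c ⊆ T := by simp [tableCells]

theorem restr_mem_tableCells (T : Finset V) (c : ∀ γ, I γ) : restr o T c ∈ tableCells o T := by
  rw [mem_tableCells, supp_restr]
  exact Finset.inter_subset_left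

theorem tableCells_empty : tableCells o (∅ : Finset V) = {o} := by
  ext c
  simp [supp_eq_empty]

theorem tableCells_univ : tableCells o (Finset.univ : Finset V) = Finset.univ := by
  ext c
  simp

/-- The sign `(-1)^{|F \ D|}`, for the supports `D`, `F` of the cells `c`, `j`. -/
def msign (o c j : ∀ γ, I γ) : ℝ := (-1) ^ (supp o j \ supp o c).card

omit [∀ γ, Fintype (I γ)] in
theorem msign_self (c : ∀ γ, I γ) : msign o c c = 1 := by simp [msign]

/-- The interaction at `j` of the function `f` on cells, `∑_{D ⊆ F} (-1)^{|F \ D|} f(j_D)`, where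
`F` is the support of `j`. -/
def moebius (o : ∀ γ, I γ) (f : (∀ γ, I γ) → ℝ) (j : ∀ γ, I γ) : ℝ :=
  ∑ c ∈ Finset.univ.filter (Below o · j), msign o c j * f c

/-- The `T`-table with upper sums `u`, obtained by inclusion-exclusion. -/
def inclExcl (o : ∀ γ, I γ) (u : (∀ γ, I γ) → ℝ) (T : Finset V) (c : ∀ γ, I γ) : ℝ :=
  ∑ j ∈ (tableCells o T).filter (Below o c), msign o c j * u j

omit [Fintype V] [∀ γ, Fintype (I γ)] in
theorem toggle_apply_ne {x c : ∀ γ, I γ} {γ δ : V} (h : δ ≠ γ) : toggle o x γ c δ = c δ := by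
  simp [toggle, h]

omit [Fintype V] [∀ γ, Fintype (I γ)] in
theorem toggle_apply_self {x c : ∀ γ, I γ} {γ : V} :
    toggle o x γ c γ = if c γ = o γ then x γ else o γ := by
  simp [toggle]

omit [Fintype V] [∀ γ, Fintype (I γ)] in
theorem toggle_toggle {x c : ∀ γ, I γ} {γ : V} (hx : x γ ≠ o γ) (hc : c γ = o γ ∨ c γ = x γ) :
    toggle o x γ (toggle o x γ c) = c := by
  funext δ
  by_cases h : δ = γ
  · subst h
    rw [toggle_apply_self, toggle_apply_self]
    rcases hc with h | h
    · simp [h, hx]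
    · simp [h, hx]
  · rw [toggle_apply_ne h, toggle_apply_ne h]

omit [Fintype V] [∀ γ, Fintype (I γ)] in
theorem toggle_ne {x c : ∀ γ, I γ} {γ : V} (hx : x γ ≠ o γ) : toggle o x γ c ≠ c := by
  intro h
  have := congrFun h γ
  rw [toggle_apply_self] at this
  split_ifs at this with h'
  · exact hx (this.trans h')
  · exact h' this.symm

omit [Fintype V] [∀ γ, Fintype (I γ)] in
theorem toggle_below {x c : ∀ γ, I γ} {γ : V} (h : Below o c x) : Below o (toggle o x γ c) x := by
  intro δ
  by_cases hδ : δ = γ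
  · subst hδ
    rw [toggle_apply_self]
    split_ifs <;> simp
  · rw [toggle_apply_ne hδ]
    exact h δ

omit [∀ γ, Fintype (I γ)] in
theorem neg_one_pow_card_supp_toggle {x c : ∀ γ, I γ} {γ : V} (hx : x γ ≠ o γ) :
    (-1 : ℝ) ^ (supp o (toggle o x γ c)).card = -(-1) ^ (supp o c).card := by
  by_cases hc : c γ = o γ
  · have : supp o (toggle o x γ c) = insert γ (supp o c) := by
      ext δ
      by_cases hδ : δ = γ
      · subst hδ
        simp [toggle_apply_self, hc, hx]
      · simp [toggle_apply_ne hδ, hδ]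
    rw [this, Finset.card_insert_of_notMem (by simpa using hc), pow_succ]
    ring
  · have : supp o c = insert γ (supp o (toggle o x γ c)) := by
      ext δ
      by_cases hδ : δ = γ
      · subst hδ
        simp [hc]
      · simp [toggle_apply_ne hδ, hδ]
    rw [this, Finset.card_insert_of_notMem (by simp [toggle_apply_self, hc]), pow_succ]
    ring

omit [∀ γ, Fintype (I γ)] in
theorem msign_eq {c j : ∀ γ, I γ} (h : supp o c ⊆ supp o j) :
    msign o c j = (-1) ^ (supp o j).card * (-1) ^ (supp o c).card := by
  have := Finset.card_sdiff_add_card_eq_card h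
  rw [msign, ← this, pow_add, mul_assoc, ← pow_add, Even.neg_one_pow ⟨_, rfl⟩, mul_one]

theorem moebius_eq_zero {T : Finset V} {f : (∀ γ, I γ) → ℝ} (hf : DependsOn f (T : Set V))
    {j : ∀ γ, I γ} (hj : ¬ supp o j ⊆ T) : moebius o f j = 0 := by
  obtain ⟨γ, hγj, hγT⟩ := Finset.not_subset.1 hj
  rw [mem_supp] at hγj
  refine Finset.sum_involution (fun c _ => toggle o j γ c) ?_ ?_ ?_ ?_
  · intro c hc
    have hc' : Below o c j := (Finset.mem_filter.1 hc).2
    rw [msign_eq hc'.supp_subset, msign_eq (toggle_below hc').supp_subset,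
      neg_one_pow_card_supp_toggle hγj,
      hf (x := toggle o j γ c) (y := c) fun δ hδ => toggle_apply_ne fun h => hγT (h ▸ hδ)]
    ring
  · intro c _ _
    exact toggle_ne hγj
  · intro c hc
    simpa using toggle_below (by simpa using hc)
  · intro c hc
    exact toggle_toggle hγj ((Finset.mem_filter.1 hc).2 γ)

theorem sum_msign_between {c x : ∀ γ, I γ} (hc : Below o c x) :
    ∑ j ∈ Finset.univ.filter (fun j => Below o c j ∧ Below o j x), msign o c j =
      if c = x then 1 else 0 := by
  split_ifs with h
  · subst h
    rw [Finset.sum_eq_single_of_mem c (by simp [Below.refl])]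
    · exact msign_self c
    · intro j hj hne
      obtain ⟨-, h1, h2⟩ := Finset.mem_filter.1 hj
      exact absurd (h2.eq_of_card_le (Finset.card_le_card h1.supp_subset)) hne
  · obtain ⟨γ, hγ⟩ := Function.ne_iff.1 h
    have hco : c γ = o γ := (hc γ).resolve_right hγ
    have hx : x γ ≠ o γ := fun h => hγ (hco.trans h.symm)
    have key : ∀ j, Below o c j → Below o c (toggle o x γ j) := by
      intro j hj δ
      by_cases hδ : δ = γ
      · subst hδ
        exact Or.inl hco
      · rw [toggle_apply_ne hδ]
        exact hj δ
    refine Finset.sum_involution (fun j _ => toggle o x γ j) ?_ ?_ ?_ ?_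
    · intro j hj
      obtain ⟨-, h1, h2⟩ := Finset.mem_filter.1 hj
      rw [msign_eq h1.supp_subset, msign_eq (key j h1).supp_subset,
        neg_one_pow_card_supp_toggle hx]
      ring
    · intro j _ _
      exact toggle_ne hx
    · intro j hj
      obtain ⟨-, h1, h2⟩ := Finset.mem_filter.1 hj
      simpa using ⟨key j h1, toggle_below h2⟩
    · intro j hj
      obtain ⟨-, h1, h2⟩ := Finset.mem_filter.1 hj
      exact toggle_toggle hx (h2 γ)

theorem sum_moebius_below (f : (∀ γ, I γ) → ℝ) (x : ∀ γ, I γ) :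
    ∑ j ∈ Finset.univ.filter (Below o · x), moebius o f j = f x := by
  unfold moebius
  rw [Finset.sum_comm' (t' := Finset.univ.filter (Below o · x))
    (s' := fun c => Finset.univ.filter (fun j => Below o c j ∧ Below o j x))]
  · simp_rw [← Finset.sum_mul]
    rw [Finset.sum_congr rfl fun c hc => by
      rw [sum_msign_between (Finset.mem_filter.1 hc).2]]
    rw [Finset.sum_eq_single_of_mem x (by simp [Below.refl])]
    · simp
    · intro c _ hne
      simp [hne]
  · intro j c
    simp only [Finset.mem_filter, Finset.mem_univ, true_and]
    exact ⟨fun h => ⟨⟨h.2, h.1⟩, h.2.trans h.1⟩, fun h => ⟨h.1.2, h.1.1⟩⟩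

theorem moebius_base (f : (∀ γ, I γ) → ℝ) : moebius o f o = f o := by
  have := sum_moebius_below (o := o) f o
  rwa [Finset.sum_eq_single_of_mem o (by simp [Below.refl])] at this
  intro j hj hne
  exact absurd ((Finset.mem_filter.1 hj).2.eq_of_card_le (by simp)) hne

theorem moebius_sum {ι : Type*} (t : Finset ι) (f : ι → (∀ γ, I γ) → ℝ) (j : ∀ γ, I γ) :
    moebius o (fun x => ∑ l ∈ t, f l x) j = ∑ l ∈ t, moebius o (f l) j := by
  simp only [moebius, Finset.mul_sum]
  exact Finset.sum_comm

theorem moebius_sub (f g : (∀ γ, I γ) → ℝ) (j : ∀ γ, I γ) :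
    moebius o (fun x => f x - g x) j = moebius o f j - moebius o g j := by
  simp only [moebius, mul_sub, Finset.sum_sub_distrib]

theorem sum_inclExcl_mul (u : (∀ γ, I γ) → ℝ) {T : Finset V} {f : (∀ γ, I γ) → ℝ}
    (hf : DependsOn f (T : Set V)) :
    ∑ c ∈ tableCells o T, inclExcl o u T c * f c = ∑ j, moebius o f j * u j := by
  rw [← Finset.sum_subset (Finset.subset_univ (tableCells o T))]
  · simp only [inclExcl, moebius, Finset.sum_mul]
    rw [Finset.sum_comm' (t' := tableCells o T)
      (s' := fun j => Finset.univ.filter (Below o · j))]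
    · exact Finset.sum_congr rfl fun j _ => Finset.sum_congr rfl fun c _ => by ring
    · intro c j
      simp only [Finset.mem_filter, Finset.mem_univ, true_and, mem_tableCells]
      exact ⟨fun h => ⟨h.2.2, h.2.1⟩, fun h => ⟨h.1.supp_subset.trans h.2, h.2, h.1⟩⟩
  · intro j _ hj
    rw [moebius_eq_zero hf (by simpa using hj), zero_mul]

theorem sum_inclExcl (u : (∀ γ, I γ) → ℝ) {T T' : Finset V} (h : T' ⊆ T) {c : ∀ γ, I γ}
    (hc : c ∈ tableCells o T') :
    ∑ i ∈ (tableCells o T).filter (fun i => restr o T' i = c), inclExcl o u T i =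
      inclExcl o u T' c := by
  set f : (∀ γ, I γ) → ℝ := fun i => if restr o T' i = c then 1 else 0 with hfdef
  have hf : DependsOn f (T' : Set V) := by
    intro x y hxy
    simp only [hfdef]
    rw [restr_congr (i := x) (j := y) hxy]
  have h1 := sum_inclExcl_mul (o := o) u hf
  have h2 := sum_inclExcl_mul (o := o) u (T := T) (f := f) (fun x y hxy => hf fun i hi => hxy i (h hi))
  rw [← h1] at h2
  simp only [hfdef, mul_ite, mul_one, mul_zero] at h2
  rw [← Finset.sum_filter, ← Finset.sum_filter] at h2
  rw [h2, Finset.sum_eq_single_of_mem c]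
  · simpa using ⟨by simpa using hc, restr_eq_self.2 (by simpa using hc)⟩
  · intro i hi hne
    obtain ⟨h3, h4⟩ := Finset.mem_filter.1 hi
    rw [restr_eq_self.2 (by simpa using h3)] at h4
    exact absurd h4 hne

theorem inclExcl_empty (u : (∀ γ, I γ) → ℝ) : inclExcl o u ∅ o = u o := by
  rw [inclExcl, tableCells_empty, Finset.filter_singleton, if_pos (Below.refl o)]
  simp [msign_self]

theorem sum_inclExcl_tableCells (u : (∀ γ, I γ) → ℝ) (T : Finset V) :
    ∑ c ∈ tableCells o T, inclExcl o u T c = u o := by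
  rw [← inclExcl_empty u, ← sum_inclExcl u (Finset.empty_subset T) (by simp)]
  refine Finset.sum_congr (Finset.filter_true_of_mem fun i _ => ?_).symm fun _ _ => rfl
  funext γ
  simp [restr]

/-- Upper sums of a table `p`: the total mass of the cells `x` with `x_D = j_D`, where `D` is the
support of `j`. -/
def upperSum (o : ∀ γ, I γ) (p : (∀ γ, I γ) → ℝ) (j : ∀ γ, I γ) : ℝ :=
  ∑ x ∈ Finset.univ.filter (Below o j), p x

theorem sum_moebius_mul_upperSum (f p : (∀ γ, I γ) → ℝ) :
    ∑ j, moebius o f j * upperSum o p j = ∑ x, p x * f x := by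
  simp only [upperSum, Finset.mul_sum]
  rw [Finset.sum_comm' (t' := Finset.univ) (s' := fun x => Finset.univ.filter (Below o · x))
    (by simp)]
  refine Finset.sum_congr rfl fun x _ => ?_
  rw [← Finset.sum_mul, sum_moebius_below, mul_comm]

theorem inclExcl_upperSum (p : (∀ γ, I γ) → ℝ) {T : Finset V} {c : ∀ γ, I γ}
    (hc : c ∈ tableCells o T) : inclExcl o (upperSum o p) T c = marg T p c := by
  set f : (∀ γ, I γ) → ℝ := fun i => if ∀ γ ∈ T, i γ = c γ then 1 else 0 with hfdef
  have hf : DependsOn f (T : Set V) := by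
    intro x y hxy
    simp only [hfdef]
    exact if_congr (forall₂_congr fun γ hγ => by rw [hxy γ hγ]) rfl rfl
  have h1 := sum_inclExcl_mul (o := o) (upperSum o p) hf
  rw [sum_moebius_mul_upperSum] at h1
  simp only [hfdef, mul_ite, mul_one, mul_zero] at h1
  rw [← Finset.sum_filter, ← Finset.sum_filter] at h1
  rw [marg, ← h1, Finset.sum_eq_single_of_mem c (by simpa using hc)]
  intro i hi hne
  obtain ⟨h3, h4⟩ := Finset.mem_filter.1 hi
  have := restr_congr (o := o) h4
  rw [restr_eq_self.2 (by simpa using h3), restr_eq_self.2 (by simpa using hc)] at this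
  exact absurd this hne

end Moebius

section ProductIntegrals

theorem lintegral_fin_prod {n : ℕ} {E : Fin n → Type*} {mE : ∀ i, MeasurableSpace (E i)}
    {μ : (i : Fin n) → Measure (E i)} [∀ i, SigmaFinite (μ i)] (f : (i : Fin n) → E i → ENNReal)
    (hf : ∀ i, Measurable (f i)) :
    ∫⁻ x : (i : Fin n) → E i, ∏ i, f i (x i) ∂(Measure.pi μ) = ∏ i, ∫⁻ x, f i x ∂(μ i) := by
  induction n with
  | zero => simp
  | succ n ih =>
    calc
      _ = ∫⁻ x : E 0 × ((i : Fin n) → E (Fin.succ i)),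
          f 0 x.1 * ∏ i : Fin n, f (Fin.succ i) (x.2 i)
          ∂((μ 0).prod (Measure.pi (fun i ↦ μ i.succ))) := by
        rw [← ((measurePreserving_piFinSuccAbove μ 0).symm).lintegral_comp]
        · refine lintegral_congr fun x => ?_
          rw [Fin.prod_univ_succ]
          rfl
        · exact Finset.measurable_prod _ fun i _ => (hf i).comp (measurable_pi_apply i)
      _ = (∫⁻ x, f 0 x ∂μ 0) * ∏ i : Fin n, ∫⁻ x, f (Fin.succ i) x ∂(μ i.succ) := by
        rw [← ih (fun i => f i.succ) (fun i => hf i.succ)]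
        exact lintegral_prod_mul (f := f 0) (g := fun x : (i : Fin n) → E i.succ => ∏ i : Fin n, f (Fin.succ i) (x i))
          (hf 0).aemeasurable (Finset.measurable_prod _ fun i _ =>
            (hf i.succ).comp (measurable_pi_apply i)).aemeasurable
      _ = ∏ i, ∫⁻ x, f i x ∂(μ i) := by rw [Fin.prod_univ_succ]

theorem lintegral_fintype_prod {ι : Type*} [Fintype ι] {E : ι → Type*}
    {mE : ∀ i, MeasurableSpace (E i)}
    {μ : (i : ι) → Measure (E i)} [∀ i, SigmaFinite (μ i)] (f : (i : ι) → E i → ENNReal)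
    (hf : ∀ i, Measurable (f i)) :
    ∫⁻ x : (i : ι) → E i, ∏ i, f i (x i) ∂(Measure.pi μ) = ∏ i, ∫⁻ x, f i x ∂(μ i) := by
  let e := (Fintype.equivFin ι).symm
  have hm : Measurable fun x : (i : ι) → E i => ∏ i, f i (x i) :=
    Finset.measurable_prod _ fun i _ => (hf i).comp (measurable_pi_apply i)
  rw [← (measurePreserving_piCongrLeft _ e).lintegral_comp hm]
  simp_rw [← e.prod_comp, MeasurableEquiv.coe_piCongrLeft, Equiv.piCongrLeft_apply_apply]
  exact lintegral_fin_prod (fun i => f (e i)) fun i => hf _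

/-- The regrouping of a vector whose coordinates are partitioned by the fibres of `b`. -/
theorem measurePreserving_glueFibers {J B : Type*} [Fintype J] [Fintype B] [DecidableEq B]
    (b : J → B) :
    MeasurePreserving (fun (Y : ∀ β, {j // b j = β} → ℝ) (j : J) => Y (b j) ⟨j, rfl⟩) where
  measurable := by fun_prop
  map_eq := by
    refine (Measure.pi_eq fun s hs => ?_).symm
    rw [Measure.map_apply (by fun_prop) (MeasurableSet.univ_pi hs)]
    have : (fun (Y : ∀ β, {j // b j = β} → ℝ) (j : J) => Y (b j) ⟨j, rfl⟩) ⁻¹' Set.univ.pi s =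
        Set.univ.pi fun β => Set.univ.pi fun j : {j // b j = β} => s j.1 := by
      ext Y
      simp only [Set.mem_preimage, Set.mem_pi, Set.mem_univ, true_implies]
      exact ⟨fun h β ⟨j, hj⟩ => by subst hj; exact h j, fun h j => h _ ⟨j, rfl⟩⟩
    rw [this, volume_pi, Measure.pi_pi]
    simp_rw [volume_pi, Measure.pi_pi]
    rw [← Fintype.prod_fiberwise b]

theorem lintegral_prod_fibers {J B : Type*} [Fintype J] [Fintype B] [DecidableEq B]
    (b : J → B) (F : ∀ β, ({j // b j = β} → ℝ) → ENNReal) (hF : ∀ β, Measurable (F β)) :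
    ∫⁻ x : J → ℝ, ∏ β, F β (fun j => x j.1) = ∏ β, ∫⁻ y, F β y := by
  rw [← (measurePreserving_glueFibers b).lintegral_comp]
  · rw [volume_pi, ← lintegral_fintype_prod F hF]
    refine lintegral_congr fun Y => Finset.prod_congr rfl fun β _ => ?_
    congr 1
    funext ⟨j, hj⟩
    subst hj
    rfl
  · exact Finset.measurable_prod _ fun β _ => (hF β).comp (by fun_prop)

theorem withDensity_map {X Y : Type*} [MeasurableSpace X] [MeasurableSpace Y] (μ : Measure X)
    {f : X → Y} (hf : Measurable f) {g : Y → ENNReal} (hg : Measurable g) :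
    (μ.map f).withDensity g = (μ.withDensity fun x => g (f x)).map f := by
  ext B hB
  rw [withDensity_apply _ hB, Measure.map_apply hf hB, withDensity_apply _ (hf hB),
    setLIntegral_map hB hg hf]

end ProductIntegrals

section Shears

variable {J : Type*} [Fintype J]

theorem measurePreserving_add_of_dependsOn (p : J → Prop) [DecidablePred p]
    (g : J → (J → ℝ) → ℝ) (hg : ∀ j, Measurable (g j))
    (hdep : ∀ j, p j → DependsOn (g j) {i | ¬ p i}) :
    MeasurePreserving (fun (x : J → ℝ) j => if p j then x j + g j x else x j) ∧
      Function.Bijective (fun (x : J → ℝ) j => if p j then x j + g j x else x j) := by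
  constructor
  · set e := MeasurableEquiv.piEquivPiSubtypeProd (fun _ : J => ℝ) p with he
    have he1 : MeasurePreserving e := volume_preserving_piEquivPiSubtypeProd (fun _ : J => ℝ) p
    have hs := (Measure.measurePreserving_swap
      (μ := (volume : Measure ({j // p j} → ℝ))) (ν := (volume : Measure ({j // ¬ p j} → ℝ))))
    have hs' := (Measure.measurePreserving_swap
      (μ := (volume : Measure ({j // ¬ p j} → ℝ))) (ν := (volume : Measure ({j // p j} → ℝ))))
    let h : ({j // ¬ p j} → ℝ) → ({j // p j} → ℝ) → ({j // p j} → ℝ) :=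
      fun a c j => c j + g j.1 (e.symm (0, a))
    have hskew : MeasurePreserving
        (fun q : ({j // ¬ p j} → ℝ) × ({j // p j} → ℝ) => (q.1, h q.1 q.2))
        (volume.prod volume) (volume.prod volume) := by
      refine (MeasurePreserving.id volume).skew_product (g := h) ?_ (Filter.Eventually.of_forall ?_)
      · refine measurable_pi_lambda _ fun j => ?_
        refine Measurable.add (by fun_prop) ((hg j.1).comp (e.symm.measurable.comp ?_))
        fun_prop
      · intro a
        exact map_add_right_eq_self volume (fun j : {j // p j} => g j.1 (e.symm (0, a)))
    have := (he1.symm.comp (hs'.comp (hskew.comp (hs.comp he1))))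
    convert this using 1
    funext x j
    by_cases hj : p j
    · have : g j x = g j (e.symm (0, fun i => x i.1)) := by
        refine hdep j hj fun i hi => ?_
        have hi' : ¬ p i := hi
        simp [he, MeasurableEquiv.piEquivPiSubtypeProd, Equiv.piEquivPiSubtypeProd, hi']
      simp only [hj, if_true, this]
      simp [he, MeasurableEquiv.piEquivPiSubtypeProd, Equiv.piEquivPiSubtypeProd, hj, h]
    · simp [he, MeasurableEquiv.piEquivPiSubtypeProd, Equiv.piEquivPiSubtypeProd, hj]
  · rw [Function.bijective_iff_has_inverse]
    refine ⟨fun x j => if p j then x j - g j x else x j, ?_, ?_⟩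
    · intro x
      funext j
      by_cases hj : p j
      · simp only [hj, if_true]
        rw [hdep j hj (x := fun j => if p j then x j + g j x else x j) (y := x) fun i hi => if_neg hi]
        ring
      · simp [hj]
    · intro x
      funext j
      by_cases hj : p j
      · simp only [hj, if_true]
        rw [hdep j hj (x := fun j => if p j then x j - g j x else x j) (y := x) fun i hi => if_neg hi]
        ring
      · simp [hj]

/-- A map that adds to each coordinate a function of the coordinates of higher rank is bijective and
preserves Lebesgue measure. -/
theorem measurePreserving_triangular (r : J → ℕ) (g : J → (J → ℝ) → ℝ)
    (hg : ∀ j, Measurable (g j)) (hdep : ∀ j, DependsOn (g j) {i | r j < r i}) :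
    MeasurePreserving (fun (x : J → ℝ) j => x j + g j x) ∧
      Function.Bijective (fun (x : J → ℝ) j => x j + g j x) := by
  have key : ∀ n, MeasurePreserving (fun (x : J → ℝ) j => if r j < n then x j + g j x else x j) ∧
      Function.Bijective (fun (x : J → ℝ) j => if r j < n then x j + g j x else x j) := by
    intro n
    induction n with
    | zero => simpa using ⟨MeasurePreserving.id volume, Function.bijective_id⟩
    | succ n ih =>
      have h := measurePreserving_add_of_dependsOn (fun j => r j = n) g hg
        (fun j hj => (hdep j).mono fun i hi => by
          simp only [Set.mem_ofPred_eq] at hi ⊢; omega)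
      have heq : (fun (x : J → ℝ) j => if r j < n + 1 then x j + g j x else x j) =
          (fun (x : J → ℝ) j => if r j = n then x j + g j x else x j) ∘
            (fun (x : J → ℝ) j => if r j < n then x j + g j x else x j) := by
        funext x j
        simp only [Function.comp_apply]
        by_cases h1 : r j = n
        · rw [if_pos (by omega), if_pos h1, if_neg (by omega),
            hdep j (x := fun j => if r j < n then x j + g j x else x j) (y := x)]
          intro i hi
          exact if_neg (by have : r j < r i := hi; omega)
        · rw [if_neg h1]
          exact if_congr (by omega) rfl rfl
      rw [heq]
      exact ⟨h.1.comp ih.1, h.2.comp ih.2⟩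
  have := key ((Finset.univ.sup r) + 1)
  have heq : (fun (x : J → ℝ) j => if r j < Finset.univ.sup r + 1 then x j + g j x else x j) =
      fun (x : J → ℝ) j => x j + g j x := by
    funext x j
    exact if_pos (Nat.lt_succ_of_le (Finset.le_sup (f := r) (Finset.mem_univ j)))
  rwa [heq] at this

end Shears

section Softmax

open Real

theorem lintegral_exp_mul_sub_exp_of_pos {a : ℝ} (ha : 0 < a) :
    ∫⁻ u : ℝ, ENNReal.ofReal (exp (a * u - exp u)) = ENNReal.ofReal (Gamma a) := by
  rw [Gamma_eq_integral ha, ofReal_integral_eq_lintegral_ofReal (GammaIntegral_convergent ha)]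
  · have := lintegral_image_eq_lintegral_abs_deriv_mul (s := Set.univ) (f := exp) (f' := exp)
      MeasurableSet.univ (fun x _ => (hasDerivAt_exp x).hasDerivWithinAt) exp_injective.injOn
      (fun x => ENNReal.ofReal (exp (-x) * x ^ (a - 1)))
    rw [Set.image_univ, range_exp] at this
    rw [this, Measure.restrict_univ]
    refine lintegral_congr fun u => ?_
    rw [← ENNReal.ofReal_mul (abs_nonneg _), abs_of_pos (exp_pos u), ← exp_mul, ← exp_add,
      ← exp_add]
    congr 2
    ring
  · refine (ae_restrict_iff' measurableSet_Ioi).2 (Filter.Eventually.of_forall fun x hx => ?_)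
    have : (0 : ℝ) < x := hx
    positivity

theorem lintegral_exp_mul_sub_exp_of_nonpos {a : ℝ} (ha : a ≤ 0) :
    ∫⁻ u : ℝ, ENNReal.ofReal (exp (a * u - exp u)) = ⊤ := by
  rw [eq_top_iff]
  calc (⊤ : ENNReal) = ∫⁻ _ in Set.Iic (0 : ℝ), ENNReal.ofReal (exp (-1)) := by
        rw [setLIntegral_const, Real.volume_Iic, ENNReal.mul_top]
        simp [exp_pos]
    _ ≤ ∫⁻ u in Set.Iic (0 : ℝ), ENNReal.ofReal (exp (a * u - exp u)) := by
        refine setLIntegral_mono' measurableSet_Iic fun u hu => ?_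
        have hu' : u ≤ 0 := hu
        refine ENNReal.ofReal_le_ofReal (exp_le_exp.2 ?_)
        have h1 : 0 ≤ a * u := mul_nonneg_of_nonpos_of_nonpos ha hu'
        have h2 : exp u ≤ 1 := exp_le_one_iff.2 hu'
        linarith
    _ ≤ _ := setLIntegral_le_lintegral _ _

theorem lintegral_ofReal_exp_ne_zero {X : Type*} [MeasurableSpace X] {μ : Measure X} [NeZero μ]
    {f : X → ℝ} (hf : Measurable f) : ∫⁻ x, ENNReal.ofReal (exp (f x)) ∂μ ≠ 0 := by
  rw [Ne, lintegral_eq_zero_iff (by fun_prop)]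
  intro h
  have : ∀ᵐ _ ∂μ, False := h.mono fun x hx => by simp [not_le.2 (exp_pos _)] at hx
  simp at this
  exact NeZero.ne μ this

theorem lintegral_exp_mul_sub_mul_exp {a z : ℝ} (ha : 0 < a) (hz : 0 < z) :
    ∫⁻ u : ℝ, ENNReal.ofReal (exp (a * u - z * exp u)) =
      ENNReal.ofReal (Gamma a) * ENNReal.ofReal (exp (-(a * log z))) := by
  rw [← lintegral_exp_mul_sub_exp_of_pos ha, ← lintegral_mul_const _ (by fun_prop),
    ← lintegral_add_right_eq_self (fun u : ℝ => ENNReal.ofReal (exp (a * u - exp u)) *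
      ENNReal.ofReal (exp (-(a * log z)))) (log z)]
  refine lintegral_congr fun u => ?_
  rw [← ENNReal.ofReal_mul (exp_pos _).le, ← exp_add, exp_add u, exp_log hz]
  congr 2
  ring

variable {K : Type*} [Fintype K]

/-- The logarithm of the kernel `∏ q_r^{a_r}`, where `q` is the probability vector with log-odds
`y` against a reference outcome with exponent `a₀`. -/
noncomputable def softmaxLogKernel (a₀ : ℝ) (a : K → ℝ) (y : K → ℝ) : ℝ :=
  ∑ r, a r * y r - (a₀ + ∑ r, a r) * log (1 + ∑ r, exp (y r))

omit [Fintype K] in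
theorem one_add_sum_exp_pos [Fintype K] (y : K → ℝ) : 0 < 1 + ∑ r, exp (y r) :=
  add_pos_of_pos_of_nonneg one_pos (Finset.sum_nonneg fun _ _ => (exp_pos _).le)

theorem measurable_softmaxLogKernel (a₀ : ℝ) (a : K → ℝ) :
    Measurable (softmaxLogKernel a₀ a) := by
  unfold softmaxLogKernel
  fun_prop

theorem gamma_mul_lintegral_softmax (a₀ : ℝ) (a : K → ℝ) (hA : 0 < a₀ + ∑ r, a r) :
    ENNReal.ofReal (Gamma (a₀ + ∑ r, a r)) *
        ∫⁻ y, ENNReal.ofReal (exp (softmaxLogKernel a₀ a y)) =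
      (∫⁻ u : ℝ, ENNReal.ofReal (exp (a₀ * u - exp u))) *
        ∏ r, ∫⁻ u : ℝ, ENNReal.ofReal (exp (a r * u - exp u)) := by
  have h1 := lintegral_fintype_prod (μ := fun _ : K => (volume : Measure ℝ))
    (fun r u => ENNReal.ofReal (exp (a r * u - exp u))) (fun r => by fun_prop)
  rw [← h1, ← volume_pi, ← lintegral_mul_const _ (by fun_prop)]
  have h2 : ∀ u : ℝ, ENNReal.ofReal (exp (a₀ * u - exp u)) *
      ∫⁻ y : K → ℝ, ∏ r, ENNReal.ofReal (exp (a r * y r - exp (y r))) =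
      ∫⁻ y : K → ℝ, ENNReal.ofReal (exp (∑ r, a r * y r)) * ENNReal.ofReal
        (exp ((a₀ + ∑ r, a r) * u - (1 + ∑ r, exp (y r)) * exp u)) := by
    intro u
    rw [← lintegral_const_mul _ (Finset.measurable_prod _ fun i _ => by fun_prop),
      ← lintegral_add_right_eq_self _ (fun _ : K => u)]
    refine lintegral_congr fun y => ?_
    rw [← ENNReal.ofReal_prod_of_nonneg fun _ _ => (exp_pos _).le,
      ← ENNReal.ofReal_mul (exp_pos _).le, ← ENNReal.ofReal_mul (exp_pos _).le, ← exp_sum,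
      ← exp_add, ← exp_add]
    congr 2
    simp only [Pi.add_apply, exp_add, mul_add, Finset.sum_sub_distrib, Finset.sum_add_distrib,
      add_mul, Finset.sum_mul]
    ring
  simp_rw [h2]
  rw [lintegral_lintegral_swap (Measurable.aemeasurable (by fun_prop)),
    ← lintegral_const_mul _ ((measurable_softmaxLogKernel a₀ a).exp.ennreal_ofReal)]
  refine lintegral_congr fun y => ?_
  rw [lintegral_const_mul _ (by fun_prop),
    lintegral_exp_mul_sub_mul_exp hA (one_add_sum_exp_pos y), mul_left_comm,
    ← ENNReal.ofReal_mul (exp_pos _).le, ← exp_add]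
  congr 3

theorem lintegral_softmax_ne_zero (a₀ : ℝ) (a : K → ℝ) :
    ∫⁻ y, ENNReal.ofReal (exp (softmaxLogKernel a₀ a y)) ≠ 0 :=
  lintegral_ofReal_exp_ne_zero (measurable_softmaxLogKernel a₀ a)

theorem pos_of_lintegral_softmax_ne_top {a₀ : ℝ} {a : K → ℝ} (hA : 0 < a₀ + ∑ r, a r)
    (h : ∫⁻ y, ENNReal.ofReal (exp (softmaxLogKernel a₀ a y)) ≠ ⊤) : 0 < a₀ ∧ ∀ r, 0 < a r := by
  have h1 := gamma_mul_lintegral_softmax a₀ a hA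
  have h2 := ENNReal.mul_ne_top (ENNReal.ofReal_ne_top (r := Gamma (a₀ + ∑ r, a r))) h
  rw [h1] at h2
  have hne : ∀ b : ℝ, ∫⁻ u : ℝ, ENNReal.ofReal (exp (b * u - exp u)) ≠ 0 :=
    fun b => lintegral_ofReal_exp_ne_zero (by fun_prop)
  constructor
  · by_contra hc
    rw [lintegral_exp_mul_sub_exp_of_nonpos (not_lt.1 hc),
      ENNReal.top_mul (Finset.prod_ne_zero_iff.2 fun r _ => hne _)] at h2
    exact h2 rfl
  · intro r
    by_contra hc
    classical
    rw [← Finset.mul_prod_erase _ _ (Finset.mem_univ r),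
      lintegral_exp_mul_sub_exp_of_nonpos (not_lt.1 hc),
      ENNReal.top_mul (Finset.prod_ne_zero_iff.2 fun r _ => hne _), ENNReal.mul_top (hne _)] at h2
    exact h2 rfl

theorem lintegral_softmax {a₀ : ℝ} {a : K → ℝ} (h₀ : 0 < a₀) (h : ∀ r, 0 < a r) :
    ∫⁻ y, ENNReal.ofReal (exp (softmaxLogKernel a₀ a y)) =
      ENNReal.ofReal (Gamma a₀ * (∏ r, Gamma (a r)) / Gamma (a₀ + ∑ r, a r)) := by
  have hA : 0 < a₀ + ∑ r, a r :=
    add_pos_of_pos_of_nonneg h₀ (Finset.sum_nonneg fun r _ => (h r).le)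
  have h1 := gamma_mul_lintegral_softmax a₀ a hA
  rw [lintegral_exp_mul_sub_exp_of_pos h₀, Finset.prod_congr rfl fun r _ =>
    lintegral_exp_mul_sub_exp_of_pos (h r),
    ← ENNReal.ofReal_prod_of_nonneg fun r _ => (Gamma_pos_of_pos (h r)).le,
    ← ENNReal.ofReal_mul (Gamma_pos_of_pos h₀).le] at h1
  rw [ENNReal.ofReal_div_of_pos (Gamma_pos_of_pos hA), ENNReal.eq_div_iff _ ENNReal.ofReal_ne_top,
    h1]
  simpa using Gamma_pos_of_pos hA

end Softmax

section Determinants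

open Matrix

/-- The determinant of a matrix that is block triangular for the ranking `r` of its blocks. -/
theorem det_eq_prod_blocks {J B : Type*} [Fintype J] [DecidableEq J] [Fintype B] [DecidableEq B]
    (M : Matrix J J ℝ) (b : J → B) (r : B → ℕ)
    (h : ∀ i j, b i ≠ b j → r (b i) ≤ r (b j) → M i j = 0) :
    M.det = ∏ β, (Matrix.of fun i j : {j // b j = β} => M i j).det := by
  let f : B → ℕᵒᵈ ×ₗ Fin (Fintype.card B) :=
    fun β => toLex (OrderDual.toDual (r β), Fintype.equivFin B β)
  have hf : Function.Injective f := by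
    intro x y hxy
    have : (r x, Fintype.equivFin B x) = (r y, Fintype.equivFin B y) := hxy
    exact (Fintype.equivFin B).injective (Prod.ext_iff.1 this).2
  let : LinearOrder B := LinearOrder.lift' f hf
  have hM : M.BlockTriangular b := by
    intro i j hij
    refine h i j (ne_of_gt hij) ?_
    have : f (b j) < f (b i) := hij
    rcases Prod.Lex.lt_iff.1 this with h1 | h1
    · exact (show r (b i) < r (b j) from h1).le
    · exact (show r (b j) = r (b i) from h1.1).ge
  refine hM.det_fintype.trans (Finset.prod_congr rfl fun β _ => ?_)
  congr!

theorem det_scaled_covariance {K : Type*} [Fintype K] [DecidableEq K] (P : ℝ) (q : K → ℝ) :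
    (Matrix.of fun i j : K => P * (q i * ((if i = j then 1 else 0) - q j))).det =
      (∏ i, P * q i) * (1 - ∑ i, q i) := by
  have h1 : (Matrix.of fun i j : K => P * (q i * ((if i = j then 1 else 0) - q j))) =
      Matrix.diagonal (fun i => P * q i) *
        (1 + Matrix.replicateCol Unit (fun _ => (-1 : ℝ)) * Matrix.replicateRow Unit q) := by
    ext i j
    rw [Matrix.diagonal_mul]
    simp [Matrix.add_apply, Matrix.one_apply, Matrix.mul_apply]
    ring
  rw [h1, Matrix.det_mul, Matrix.det_diagonal, Matrix.det_one_add_replicateCol_mul_replicateRow]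
  simp [dotProduct, sub_eq_add_neg]

end Determinants

section Chain

variable {V : Type*} [Fintype V] [DecidableEq V] {I : V → Type*} [∀ γ, Fintype (I γ)]
  [∀ γ, DecidableEq (I γ)] {o : ∀ γ, I γ}

theorem sum_tableCells_union {U D : Finset V} {a h : (∀ γ, I γ) → ℝ}
    (ha : DependsOn a (U : Set V)) (hh : DependsOn h (D : Set V)) :
    ∑ x ∈ tableCells o (U ∪ D), a x * h x =
      ∑ y ∈ tableCells o U, a y *
        ∑ c ∈ (tableCells o D).filter (fun c => restr o (D ∩ U) c = restr o (D ∩ U) y), h c := by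
  simp_rw [Finset.mul_sum]
  rw [Finset.sum_sigma']
  refine Finset.sum_bij' (fun x _ => ⟨restr o U x, restr o D x⟩)
    (fun p _ => fun γ => if γ ∈ D then p.2 γ else p.1 γ) ?_ ?_ ?_ ?_ ?_
  · intro x _
    simp only [Finset.mem_sigma, Finset.mem_filter, restr_mem_tableCells, true_and,
      restr_eq_restr, Finset.mem_inter]
    intro γ hγ
    rw [restr_apply_of_mem hγ.1, restr_apply_of_mem hγ.2]
  · rintro ⟨y, c⟩ hp
    simp only [Finset.mem_sigma, Finset.mem_filter, mem_tableCells] at hp ⊢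
    intro γ hγ
    rw [mem_supp] at hγ
    rw [Finset.mem_union]
    by_cases hD : γ ∈ D
    · exact Or.inr hD
    · rw [if_neg hD] at hγ
      exact Or.inl (hp.1 (mem_supp.2 hγ))
  · intro x hx
    funext γ
    by_cases hD : γ ∈ D
    · simp [hD, restr_apply_of_mem hD]
    · simp only [hD, if_false]
      by_cases hU : γ ∈ U
      · exact restr_apply_of_mem hU x
      · rw [restr_apply_of_notMem hU]
        by_contra hne
        have := mem_tableCells.1 hx (mem_supp.2 (Ne.symm hne))
        simp [hD, hU] at this
  · rintro ⟨y, c⟩ hp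
    simp only [Finset.mem_sigma, Finset.mem_filter, mem_tableCells, restr_eq_restr,
      Finset.mem_inter] at hp
    have h1 : restr o U (fun γ => if γ ∈ D then c γ else y γ) = y := by
      refine (restr_congr fun γ hγ => ?_).trans (restr_eq_self.2 hp.1)
      by_cases hD : γ ∈ D
      · rw [if_pos hD, hp.2.2 γ ⟨hD, hγ⟩]
      · rw [if_neg hD]
    have h2 : restr o D (fun γ => if γ ∈ D then c γ else y γ) = c := by
      exact (restr_congr fun γ hγ => if_pos hγ).trans (restr_eq_self.2 hp.2.1)
    simp only [h1, h2]
  · intro x _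
    rw [ha (x := restr o U x) (y := x) fun γ hγ => restr_apply_of_mem hγ x,
      hh (x := restr o D x) (y := x) fun γ hγ => restr_apply_of_mem hγ x]

variable {k : ℕ} {C : Fin k → Finset V}

/-- The union of the first `n` cliques. -/
def prevUnion (C : Fin k → Finset V) (n : ℕ) : Finset V :=
  (Finset.univ.filter fun j : Fin k => j.val < n).biUnion C

omit [Fintype V] in
theorem mem_prevUnion {n : ℕ} {γ : V} : γ ∈ prevUnion C n ↔ ∃ j : Fin k, j.val < n ∧ γ ∈ C j := by
  simp [prevUnion]

omit [Fintype V] in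
theorem separator_eq (l : Fin k) : separator C l = C l ∩ prevUnion C l.val := rfl

omit [Fintype V] in
theorem subset_prevUnion {l : Fin k} {n : ℕ} (h : l.val < n) : C l ⊆ prevUnion C n :=
  fun _ hγ => mem_prevUnion.2 ⟨l, h, hγ⟩

omit [Fintype V] in
theorem prevUnion_zero : prevUnion C 0 = ∅ := by
  simp [prevUnion]

omit [Fintype V] in
theorem prevUnion_succ (l : Fin k) : prevUnion C (l.val + 1) = prevUnion C l.val ∪ C l := by
  ext γ
  simp only [Finset.mem_union, mem_prevUnion]
  constructor
  · rintro ⟨j, hj, hγ⟩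
    rcases Nat.lt_succ_iff_lt_or_eq.1 hj with h | h
    · exact Or.inl ⟨j, h, hγ⟩
    · rw [Fin.ext h] at hγ
      exact Or.inr hγ
  · rintro (⟨j, hj, hγ⟩ | hγ)
    · exact ⟨j, by omega, hγ⟩
    · exact ⟨l, by omega, hγ⟩

/-- The product of the first `n` factors. -/
def chainProd (q : Fin k → (∀ γ, I γ) → ℝ) (n : ℕ) (x : ∀ γ, I γ) : ℝ :=
  ∏ l ∈ Finset.univ.filter (fun l : Fin k => l.val < n), q l x

variable {q : Fin k → (∀ γ, I γ) → ℝ}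

omit [Fintype V] [DecidableEq V] [∀ γ, Fintype (I γ)] [∀ γ, DecidableEq (I γ)] in
theorem chainProd_zero (x : ∀ γ, I γ) : chainProd q 0 x = 1 := by simp [chainProd]

omit [Fintype V] [DecidableEq V] [∀ γ, Fintype (I γ)] [∀ γ, DecidableEq (I γ)] in
theorem chainProd_succ (l : Fin k) (x : ∀ γ, I γ) :
    chainProd q (l.val + 1) x = chainProd q l.val x * q l x := by
  have : Finset.univ.filter (fun j : Fin k => j.val < l.val + 1) =
      insert l (Finset.univ.filter (fun j : Fin k => j.val < l.val)) := by
    ext j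
    simp only [Finset.mem_filter, Finset.mem_univ, true_and, Finset.mem_insert, Fin.ext_iff]
    omega
  rw [chainProd, this, Finset.prod_insert (by simp), mul_comm]
  rfl

omit [Fintype V] [DecidableEq V] [∀ γ, Fintype (I γ)] [∀ γ, DecidableEq (I γ)] in
theorem chainProd_last (x : ∀ γ, I γ) : chainProd q k x = ∏ l, q l x := by
  rw [chainProd, Finset.filter_true_of_mem fun l _ => l.isLt]

omit [Fintype V] [∀ γ, Fintype (I γ)] [∀ γ, DecidableEq (I γ)] in
theorem dependsOn_chainProd (hq : ∀ l, DependsOn (q l) (C l : Set V)) (n : ℕ) :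
    DependsOn (chainProd q n) (prevUnion C n : Set V) := by
  intro x y h
  refine Finset.prod_congr rfl fun l hl => hq l fun γ hγ => h γ ?_
  exact subset_prevUnion (Finset.mem_filter.1 hl).2 hγ

variable (hq : ∀ l, DependsOn (q l) (C l : Set V))
  (hsum : ∀ l y, ∑ c ∈ (tableCells o (C l)).filter
    (fun c => restr o (separator C l) c = restr o (separator C l) y), q l c = 1)

include hq in
theorem sum_chainProd_succ_mul (l : Fin k) {f h : (∀ γ, I γ) → ℝ}
    (hf : DependsOn f (prevUnion C l.val : Set V)) (hh : DependsOn h (C l : Set V)) :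
    ∑ x ∈ tableCells o (prevUnion C (l.val + 1)), chainProd q (l.val + 1) x * (f x * h x) =
      ∑ y ∈ tableCells o (prevUnion C l.val), chainProd q l.val y * f y *
        ∑ c ∈ (tableCells o (C l)).filter
          (fun c => restr o (separator C l) c = restr o (separator C l) y), q l c * h c := by
  rw [prevUnion_succ, separator_eq,
    ← sum_tableCells_union (a := fun x => chainProd q l.val x * f x) (h := fun x => q l x * h x)]
  · refine Finset.sum_congr rfl fun x _ => ?_
    rw [chainProd_succ]
    ring
  · intro x y hxy
    simp only
    rw [dependsOn_chainProd hq _ hxy, hf hxy]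
  · intro x y hxy
    simp only
    rw [hq l hxy, hh hxy]

include hq hsum in
theorem sum_chainProd_mul {n m : ℕ} (hnm : n ≤ m) (hm : m ≤ k) {f : (∀ γ, I γ) → ℝ}
    (hf : DependsOn f (prevUnion C n : Set V)) :
    ∑ x ∈ tableCells o (prevUnion C m), chainProd q m x * f x =
      ∑ x ∈ tableCells o (prevUnion C n), chainProd q n x * f x := by
  induction m, hnm using Nat.le_induction with
  | base => rfl
  | succ m hnm ih =>
    rw [← ih (by omega)]
    have hf' : DependsOn f (prevUnion C m : Set V) := fun x y h => hf fun γ hγ => h γ (by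
      obtain ⟨j, hj, hγj⟩ := mem_prevUnion.1 hγ
      exact mem_prevUnion.2 ⟨j, by omega, hγj⟩)
    have := sum_chainProd_succ_mul (o := o) hq ⟨m, hm⟩ (h := fun _ => 1) hf' (fun _ _ _ => rfl)
    simp only [mul_one, hsum] at this
    exact this

omit [∀ γ, Fintype (I γ)] in
theorem dependsOn_agree (S : Finset V) (c : ∀ γ, I γ) :
    DependsOn (fun x : ∀ γ, I γ => if ∀ γ ∈ S, x γ = c γ then (1 : ℝ) else 0) (S : Set V) :=
  fun _ _ hxy => if_congr (forall₂_congr fun γ hγ => by rw [hxy γ hγ]) rfl rfl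

variable (hcov : prevUnion C k = Finset.univ)

include hq hsum hcov

theorem marg_prod {n : ℕ} (hn : n ≤ k) {S : Finset V} (hS : S ⊆ prevUnion C n) (c : ∀ γ, I γ) :
    marg S (fun x => ∏ l, q l x) c = ∑ x ∈ tableCells o (prevUnion C n),
      chainProd q n x * if ∀ γ ∈ S, x γ = c γ then 1 else 0 := by
  rw [← sum_chainProd_mul hq hsum hn le_rfl
    (fun x y hxy => dependsOn_agree S c fun γ hγ => hxy γ (hS hγ)), hcov, tableCells_univ, marg,
    Finset.sum_filter]
  simp [chainProd_last]

theorem sum_prod_eq_one : ∑ x, ∏ l, q l x = 1 := by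
  have := marg_prod hq hsum hcov (Nat.zero_le k) (Finset.empty_subset _) o
  simpa [marg, prevUnion_zero, tableCells_empty, chainProd_zero] using this

theorem marg_clique_prod (l : Fin k) (c : ∀ γ, I γ) :
    marg (C l) (fun x => ∏ l, q l x) c =
      q l c * marg (separator C l) (fun x => ∏ l, q l x) c := by
  rw [marg_prod hq hsum hcov (n := l.val + 1) l.isLt (subset_prevUnion (Nat.lt_succ_self _)),
    marg_prod hq hsum hcov (n := l.val) l.isLt.le
      (show separator C l ⊆ prevUnion C l.val from Finset.inter_subset_right)]
  have := sum_chainProd_succ_mul (o := o) hq l (f := fun _ => 1) (fun _ _ _ => rfl)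
    (dependsOn_agree (C l) c)
  simp only [one_mul, mul_one] at this
  rw [this, Finset.mul_sum]
  refine Finset.sum_congr rfl fun y _ => ?_
  rw [mul_left_comm]
  congr 1
  simp only [mul_ite, mul_one, mul_zero]
  rw [← Finset.sum_filter, Finset.filter_filter]
  split_ifs with h
  · rw [Finset.sum_eq_single_of_mem (restr o (C l) c)]
    · exact hq l fun γ hγ => restr_apply_of_mem hγ c
    · simp only [Finset.mem_filter, restr_mem_tableCells, true_and, restr_eq_restr]
      refine ⟨fun γ hγ => ?_, fun γ hγ => restr_apply_of_mem hγ c⟩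
      rw [restr_apply_of_mem (Finset.mem_of_mem_inter_left hγ), h γ hγ]
    · intro c' hc' hne
      obtain ⟨h1, -, h3⟩ := Finset.mem_filter.1 hc'
      refine absurd ?_ hne
      rw [← restr_eq_self.2 (mem_tableCells.1 h1)]
      exact restr_congr h3
  · refine Finset.sum_eq_zero fun c' hc' => absurd (fun γ hγ => ?_) h
    obtain ⟨-, h2, h3⟩ := Finset.mem_filter.1 hc'
    rw [restr_eq_restr] at h2
    rw [← h2 γ hγ, h3 γ (Finset.mem_of_mem_inter_left hγ)]

end Chain

section PerfectOrdering

variable {V : Type*} [Fintype V] [DecidableEq V] {G : SimpleGraph V} {k : ℕ}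
  {C : Fin k → Finset V}

omit [Fintype V] in
theorem IsPerfectOrdering.isClique (hC : IsPerfectOrdering G C) (l : Fin k) :
    G.IsClique (C l : Set V) := ((hC.range_eq (C l)).1 ⟨l, rfl⟩).prop

theorem IsPerfectOrdering.exists_subset (hC : IsPerfectOrdering G C) {D : Finset V}
    (hD : G.IsClique (D : Set V)) : ∃ l, D ⊆ C l := by
  obtain ⟨B, hDB, hB⟩ := Set.toFinite {B : Finset V | G.IsClique (B : Set V)} |>.exists_le_maximal hD
  obtain ⟨l, rfl⟩ := (hC.range_eq B).2 hB
  exact ⟨l, hDB⟩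

theorem IsPerfectOrdering.pos (hC : IsPerfectOrdering G C) : 0 < k := by
  obtain ⟨l, -⟩ := hC.exists_subset (D := ∅) (by simp)
  exact l.pos

theorem IsPerfectOrdering.prevUnion_eq_univ (hC : IsPerfectOrdering G C) :
    prevUnion C k = Finset.univ := by
  ext γ
  obtain ⟨l, hl⟩ := hC.exists_subset (D := {γ}) (by simp)
  simpa [mem_prevUnion] using ⟨l, hl (Finset.mem_singleton_self γ)⟩

omit [Fintype V] in
theorem separator_eq_empty {l : Fin k} (hl : l ∉ sepIdx k) : separator C l = ∅ := by
  have : l.val = 0 := by simpa [sepIdx] using hl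
  rw [separator_eq, this, prevUnion_zero, Finset.inter_empty]

omit [Fintype V] in
theorem separator_subset (l : Fin k) : separator C l ⊆ C l := Finset.inter_subset_left

theorem IsPerfectOrdering.existsUnique_block (hC : IsPerfectOrdering G C) {D : Finset V}
    (hD : D.Nonempty) (hD' : G.IsClique (D : Set V)) :
    ∃! l, D ⊆ C l ∧ ¬ D ⊆ separator C l := by
  have hne : (Finset.univ.filter fun l => D ⊆ C l).Nonempty := by
    obtain ⟨l, hl⟩ := hC.exists_subset hD'
    exact ⟨l, by simpa using hl⟩
  obtain ⟨l, hl, hmin⟩ := Finset.exists_min_image _ id hne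
  simp only [Finset.mem_filter, Finset.mem_univ, true_and, id] at hl hmin
  have hlt : ∀ {a b : Fin k}, a < b → D ⊆ C a → D ⊆ C b → D ⊆ separator C b := fun hab ha hb =>
    Finset.subset_inter hb (ha.trans (subset_prevUnion hab))
  refine ⟨l, ⟨hl, fun hs => ?_⟩, fun m hm => ?_⟩
  · by_cases h0 : l ∈ sepIdx k
    · obtain ⟨j, hj, hsub⟩ := hC.running_intersection l h0
      exact absurd (hmin j (hs.trans hsub)) (not_le.2 hj)
    · rw [separator_eq_empty h0, Finset.subset_empty] at hs
      exact hD.ne_empty hs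
  · rcases lt_or_eq_of_le (hmin m hm.1) with h | h
    · exact absurd (hlt h hl hm.1) hm.2
    · exact h.symm

theorem prod_eq_mul_prod_sepIdx {M : Type*} [CommMonoid M] (hk : 0 < k) (f : Fin k → M) :
    ∏ l, f l = f ⟨0, hk⟩ * ∏ l ∈ sepIdx k, f l := by
  have : (Finset.univ : Finset (Fin k)) = insert ⟨0, hk⟩ (sepIdx k) := by
    ext l
    simp only [Finset.mem_univ, Finset.mem_insert, sepIdx, Finset.mem_filter, true_and, Fin.ext_iff,
      true_iff]
    omega
  rw [this, Finset.prod_insert (by simp [sepIdx])]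

end PerfectOrdering

section Blocks

variable {V : Type*} [Fintype V] [DecidableEq V] {I : V → Type*} [∀ γ, Fintype (I γ)]
  [∀ γ, DecidableEq (I γ)] {o : ∀ γ, I γ} {G : SimpleGraph V} {k : ℕ} {C : Fin k → Finset V}

/-- The cells of the separator tables, over which the conditional tables of the residuals given the
separators are indexed. -/
abbrev Block (o : ∀ γ, I γ) (C : Fin k → Finset V) : Type _ :=
  Σ l : Fin k, {d : ∀ γ, I γ // d ∈ tableCells o (separator C l)}

/-- The clique in whose residual part the interaction `j` lies. -/
noncomputable def IsPerfectOrdering.cliqueIdx (hC : IsPerfectOrdering G C) (j : Idx G o) : Fin k :=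
  (hC.existsUnique_block j.2.1 j.2.2).choose

omit [∀ γ, Fintype (I γ)] in
theorem IsPerfectOrdering.supp_subset_cliqueIdx (hC : IsPerfectOrdering G C) (j : Idx G o) :
    supp o j.1 ⊆ C (hC.cliqueIdx j) := (hC.existsUnique_block j.2.1 j.2.2).choose_spec.1.1

omit [∀ γ, Fintype (I γ)] in
theorem IsPerfectOrdering.not_supp_subset_separator (hC : IsPerfectOrdering G C) (j : Idx G o) :
    ¬ supp o j.1 ⊆ separator C (hC.cliqueIdx j) :=
  (hC.existsUnique_block j.2.1 j.2.2).choose_spec.1.2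

omit [∀ γ, Fintype (I γ)] in
theorem IsPerfectOrdering.cliqueIdx_eq (hC : IsPerfectOrdering G C) {j : Idx G o} {l : Fin k}
    (h1 : supp o j.1 ⊆ C l) (h2 : ¬ supp o j.1 ⊆ separator C l) : hC.cliqueIdx j = l :=
  (hC.existsUnique_block j.2.1 j.2.2).unique
    ⟨hC.supp_subset_cliqueIdx j, hC.not_supp_subset_separator j⟩ ⟨h1, h2⟩

/-- The cell of a separator table over which the interaction `j` lies. -/
noncomputable def IsPerfectOrdering.block (hC : IsPerfectOrdering G C) (j : Idx G o) :
    Block o C :=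
  ⟨hC.cliqueIdx j, restr o _ j.1, restr_mem_tableCells _ _⟩

/-- The cells of the table of the clique `C l` that lie over a cell of the table of the
separator. -/
def blockCells (β : Block o C) : Finset (∀ γ, I γ) :=
  (tableCells o (C β.1)).filter fun c => restr o (separator C β.1) c = β.2

theorem IsPerfectOrdering.block_eq_iff (hC : IsPerfectOrdering G C) {j : Idx G o}
    {β : Block o C} : hC.block j = β ↔ j.1 ∈ blockCells β ∧ j.1 ≠ β.2 := by
  obtain ⟨l, d, hd⟩ := β
  simp only [blockCells, Finset.mem_filter, mem_tableCells]
  constructor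
  · intro h
    obtain ⟨rfl, h2⟩ := Sigma.mk.inj_iff.1 h
    have h3 : restr o _ j.1 = d := congrArg Subtype.val (eq_of_heq h2)
    refine ⟨⟨hC.supp_subset_cliqueIdx j, h3⟩, fun hj => hC.not_supp_subset_separator j ?_⟩
    rw [hj]
    exact mem_tableCells.1 hd
  · rintro ⟨⟨h1, h2⟩, h3⟩
    have : hC.cliqueIdx j = l := hC.cliqueIdx_eq h1 fun hs => h3 (by
      rw [← h2, restr_eq_self.2 hs])
    subst this
    exact Sigma.ext rfl (heq_of_eq (Subtype.ext h2))

theorem mem_blockCells_self (β : Block o C) : β.2.1 ∈ blockCells β := by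
  have := mem_tableCells.1 β.2.2
  simpa [blockCells] using ⟨this.trans (separator_subset _), restr_eq_self.2 this⟩

theorem IsPerfectOrdering.isInteraction_of_mem_blockCells (hC : IsPerfectOrdering G C)
    {β : Block o C} {c : ∀ γ, I γ} (hc : c ∈ blockCells β) (hne : c ≠ β.2) :
    IsInteraction G (supp o c) := by
  obtain ⟨h1, h2⟩ := Finset.mem_filter.1 hc
  refine ⟨?_, (hC.isClique β.1).subset (by exact_mod_cast mem_tableCells.1 h1)⟩
  rw [Finset.nonempty_iff_ne_empty, Ne, supp_eq_empty]
  rintro rfl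
  exact hne (by rw [← h2, restr_eq_self.2 (by simp)])

@[to_additive]
theorem IsPerfectOrdering.prod_blockCells (hC : IsPerfectOrdering G C) {M : Type*} [CommMonoid M]
    (β : Block o C) [Fintype {j : Idx G o // hC.block j = β}] (f : (∀ γ, I γ) → M) :
    ∏ c ∈ blockCells β, f c = f β.2 * ∏ j : {j : Idx G o // hC.block j = β}, f j.1.1 := by
  rw [← Finset.mul_prod_erase _ _ (mem_blockCells_self β)]
  congr 1
  refine (Finset.prod_bij (fun j _ => j.1.1) ?_ ?_ ?_ fun _ _ => rfl).symm
  · intro j _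
    obtain ⟨h1, h2⟩ := hC.block_eq_iff.1 j.2
    exact Finset.mem_erase.2 ⟨h2, h1⟩
  · intro i _ j _ h
    exact Subtype.ext (Subtype.ext h)
  · intro c hc
    obtain ⟨h1, h2⟩ := Finset.mem_erase.1 hc
    exact ⟨⟨⟨c, hC.isInteraction_of_mem_blockCells h2 h1⟩, hC.block_eq_iff.2 ⟨h2, h1⟩⟩,
      Finset.mem_univ _, rfl⟩

theorem prod_blocks {M : Type*} [CommMonoid M] (f : Fin k → (∀ γ, I γ) → M) :
    ∏ β : Block o C, f β.1 β.2 = ∏ l, ∏ d ∈ tableCells o (separator C l), f l d := by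
  rw [Fintype.prod_sigma]
  exact Finset.prod_congr rfl fun l _ => Finset.prod_coe_sort _ (f l)

@[to_additive]
theorem prod_tableCells_eq_prod_blockCells {M : Type*} [CommMonoid M]
    (f : Fin k → (∀ γ, I γ) → M) :
    ∏ l, ∏ c ∈ tableCells o (C l), f l c =
      ∏ β : Block o C, ∏ c ∈ blockCells β, f β.1 c := by
  rw [Fintype.prod_sigma]
  refine Finset.prod_congr rfl fun l _ => ?_
  rw [← Finset.prod_fiberwise_of_maps_to (t := tableCells o (separator C l))
    (g := restr o (separator C l)) fun c _ => restr_mem_tableCells _ c]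
  exact (Finset.prod_coe_sort _ fun d => ∏ c ∈ (tableCells o (C l)).filter
    fun c => restr o (separator C l) c = d, f l c).symm

end Blocks

section Parameters

variable {V : Type*} [Fintype V] [DecidableEq V] {I : V → Type*} [∀ γ, Fintype (I γ)]
  [∀ γ, DecidableEq (I γ)] {o : ∀ γ, I γ} {G : SimpleGraph V} [DecidableRel G.Adj]

omit [∀ γ, Fintype (I γ)] in
theorem val_coe (x : Idx G o → ℝ) (j : Idx G o) : val G o x j.1 = x j := dif_pos j.2

omit [∀ γ, Fintype (I γ)] in
theorem val_of_not {x : Idx G o → ℝ} {i : ∀ γ, I γ} (h : ¬ IsInteraction G (supp o i)) :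
    val G o x i = 0 := dif_neg h

/-- The family `x`, extended by the value `t` at the empty set of factors and by `0` at the sets
that are not complete. -/
def extend (G : SimpleGraph V) [DecidableRel G.Adj] (o : ∀ γ, I γ) (x : Idx G o → ℝ) (t : ℝ)
    (i : ∀ γ, I γ) : ℝ :=
  if i = o then t else val G o x i

omit [∀ γ, Fintype (I γ)] in
theorem extend_base (x : Idx G o → ℝ) (t : ℝ) : extend G o x t o = t := if_pos rfl

omit [∀ γ, Fintype (I γ)] in
theorem extend_of_ne (x : Idx G o → ℝ) (t : ℝ) {i : ∀ γ, I γ} (h : i ≠ o) :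
    extend G o x t i = val G o x i := if_neg h

theorem hyperParam_eq_inclExcl (s : Idx G o → ℝ) (α : ℝ) (T : Finset V) (c : ∀ γ, I γ) :
    hyperParam G o s α T c = inclExcl o (extend G o s α) T c := by
  unfold hyperParam inclExcl
  split_ifs with hc
  · subst hc
    rw [Finset.filter_true_of_mem fun j _ => below_base j]
    have hmem : c ∈ tableCells c T := by simp
    rw [← Finset.add_sum_erase _ _ hmem, extend_base, msign_self, one_mul]
    congr 1
    rw [← Finset.sum_fiberwise_of_maps_to (s := (tableCells c T).erase c)
      (t := T.powerset.filter Finset.Nonempty) (g := supp c)]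
    · refine Finset.sum_congr rfl fun D hD => ?_
      rw [Finset.mul_sum]
      have hD' := Finset.mem_filter.1 hD
      have heq : ((tableCells c T).erase c).filter (fun i => supp c i = D) = starCells c D := by
        ext j
        simp only [Finset.mem_filter, Finset.mem_erase, mem_tableCells, starCells,
          Finset.mem_univ, true_and]
        constructor
        · exact fun h => h.2
        · rintro rfl
          exact ⟨⟨fun h => by simp [h] at hD', Finset.mem_powerset.1 hD'.1⟩, rfl⟩
      rw [heq]
      refine Finset.sum_congr rfl fun j hj => ?_
      have hj' : supp c j = D := by simpa [starCells] using hj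
      have hne : j ≠ c := by
        rintro rfl
        rw [supp_base] at hj'
        simp [← hj'] at hD'
      rw [extend_of_ne _ _ hne, msign, hj', supp_base, Finset.sdiff_empty]
    · intro j hj
      obtain ⟨h1, h2⟩ := Finset.mem_erase.1 hj
      simp only [Finset.mem_filter, Finset.mem_powerset]
      refine ⟨mem_tableCells.1 h2, ?_⟩
      rwa [Finset.nonempty_iff_ne_empty, Ne, supp_eq_empty]
  · rw [← Finset.sum_fiberwise_of_maps_to (s := (tableCells o T).filter (Below o c))
      (t := T.powerset.filter (fun F => supp o c ⊆ F)) (g := supp o)]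
    · refine Finset.sum_congr rfl fun F hF => ?_
      have hF' := Finset.mem_filter.1 hF
      have heq : ((tableCells o T).filter (Below o c)).filter (fun i => supp o i = F) =
          (starCells o F).filter (fun j => restr o (supp o c) j = c) := by
        ext j
        simp only [Finset.mem_filter, mem_tableCells, starCells, Finset.mem_univ, true_and,
          below_iff_restr]
        constructor
        · exact fun h => ⟨h.2, h.1.2⟩
        · rintro ⟨rfl, h⟩
          exact ⟨⟨Finset.mem_powerset.1 hF'.1, h⟩, rfl⟩
      rw [heq]
      refine Finset.sum_congr rfl fun j hj => ?_
      have hj' := Finset.mem_filter.1 hj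
      have hj1 : supp o j = F := by simpa [starCells] using hj'.1
      have hne : j ≠ o := by
        rintro rfl
        have := (below_iff_restr.2 hj'.2).supp_subset
        rw [supp_base, Finset.subset_empty, supp_eq_empty] at this
        exact hc this
      rw [extend_of_ne _ _ hne, msign, hj1]
    · intro j hj
      obtain ⟨h1, h2⟩ := Finset.mem_filter.1 hj
      simp only [Finset.mem_filter, Finset.mem_powerset]
      exact ⟨mem_tableCells.1 h1, h2.supp_subset⟩

theorem logOdds_eq_sum_below (θ : Idx G o → ℝ) (x : ∀ γ, I γ) :
    logOdds G o θ x = ∑ j ∈ Finset.univ.filter (Below o · x), val G o θ j := by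
  have hs : ∀ D ⊆ supp o x, supp o (restr o D x) = D := fun D hD => by
    rw [supp_restr, Finset.inter_eq_left.2 hD]
  rw [logOdds, Finset.sum_filter_of_ne]
  · refine Finset.sum_nbij' (fun D => restr o D x) (supp o) ?_ ?_ ?_ ?_ fun _ _ => rfl
    · intro D _
      simpa using restr_below D x
    · intro j hj
      exact Finset.mem_powerset.2 (Finset.mem_filter.1 hj).2.supp_subset
    · intro D hD
      exact hs D (Finset.mem_powerset.1 hD)
    · intro j hj
      exact below_iff_restr.1 (Finset.mem_filter.1 hj).2
  · intro D hD hne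
    by_contra h
    exact hne (val_of_not (by rwa [hs D (Finset.mem_powerset.1 hD)]))

variable {f : (∀ γ, I γ) → ℝ}
  (hf : ∀ j, j ≠ o → ¬ IsInteraction G (supp o j) → moebius o f j = 0)

include hf

theorem logOdds_moebius (x : ∀ γ, I γ) :
    logOdds G o (fun j => moebius o f j.1) x = f x - f o := by
  have ho : o ∈ Finset.univ.filter (Below o · x) := by simp [below_base]
  rw [logOdds_eq_sum_below, ← sum_moebius_below (o := o) f x, ← Finset.add_sum_erase _ _ ho,
    ← Finset.add_sum_erase _ (moebius o f) ho, moebius_base, add_sub_cancel_left,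
    val_of_not (by simp [IsInteraction]), zero_add]
  refine Finset.sum_congr rfl fun j hj => ?_
  by_cases h : IsInteraction G (supp o j)
  · exact dif_pos h
  · rw [val_of_not h, hf j (Finset.ne_of_mem_erase hj) h]

variable (hsum : ∑ x, Real.exp (f x) = 1)

include hsum

theorem partitionFn_moebius :
    partitionFn G o (fun j => moebius o f j.1) = Real.exp (-f o) := by
  have h : ∀ x, Real.exp (logOdds G o (fun j => moebius o f j.1) x) =
      Real.exp (f x) * Real.exp (-f o) := fun x => by
    rw [logOdds_moebius hf, sub_eq_add_neg, Real.exp_add]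
  have h1 : (1 : ℝ) = Real.exp (f o) * Real.exp (-f o) := by rw [← Real.exp_add]; simp
  simp only [partitionFn, h]
  conv_lhs => arg 1; rw [h1]
  rw [Finset.add_sum_erase _ (fun x => Real.exp (f x) * Real.exp (-f o)) (Finset.mem_univ o),
    ← Finset.sum_mul, hsum, one_mul]

theorem cellProb_moebius (x : ∀ γ, I γ) :
    cellProb G o (fun j => moebius o f j.1) x = Real.exp (f x) := by
  rw [cellProb, partitionFn_moebius hf hsum, logOdds_moebius hf, ← Real.exp_sub]
  congr 1
  ring

theorem priorKernel_moebius (s : Idx G o → ℝ) (α : ℝ) :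
    priorKernel G o s α (fun j => moebius o f j.1) =
      Real.exp (∑ j, moebius o f j * extend G o s α j) := by
  rw [priorKernel, partitionFn_moebius hf hsum, Real.log_exp]
  congr 1
  rw [← Finset.add_sum_erase _ _ (Finset.mem_univ o), moebius_base, extend_base]
  have h1 : ∑ j : Idx G o, moebius o f j.1 * s j =
      ∑ j ∈ Finset.univ.filter (fun j : ∀ γ, I γ => IsInteraction G (supp o j)),
        moebius o f j * val G o s j := by
    rw [Finset.sum_subtype (p := fun j => IsInteraction G (supp o j)) _ (by simp)]
    exact Finset.sum_congr rfl fun j _ => by rw [val_coe]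
  have h2 : ∑ j ∈ Finset.univ.erase o, moebius o f j * extend G o s α j =
      ∑ j ∈ Finset.univ.filter (fun j : ∀ γ, I γ => IsInteraction G (supp o j)),
        moebius o f j * val G o s j := by
    rw [Finset.sum_congr rfl fun j hj => by rw [extend_of_ne _ _ (Finset.ne_of_mem_erase hj)]]
    refine (Finset.sum_subset ?_ ?_).symm
    · intro j hj
      refine Finset.mem_erase.2 ⟨?_, Finset.mem_univ _⟩
      intro h
      obtain ⟨γ, hγ⟩ := (Finset.mem_filter.1 hj).2.1
      rw [h, supp_base] at hγ
      exact Finset.notMem_empty γ hγ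
    · intro j _ hj
      rw [val_of_not (by simpa using hj), mul_zero]
  rw [h1, h2]
  ring

end Parameters

section Conditionals

variable {V : Type*} [Fintype V] [DecidableEq V] {I : V → Type*} [∀ γ, Fintype (I γ)]
  [∀ γ, DecidableEq (I γ)] {o : ∀ γ, I γ} {G : SimpleGraph V} [DecidableRel G.Adj] {k : ℕ}

variable (C : Fin k → Finset V)

/-- The logarithm of the unnormalised conditional table of the residual of the clique `C l` given
the separator, for the log-odds `η` against the base cell of the residual. -/
def logWeight (η : Idx G o → ℝ) (l : Fin k) (x : ∀ γ, I γ) : ℝ :=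
  if supp o (restr o (C l) x) ⊆ separator C l then 0 else val G o η (restr o (C l) x)

/-- The normaliser of the conditional table of the residual of a clique given the separator. -/
noncomputable def condNorm (η : Idx G o → ℝ) (l : Fin k) (x : ∀ γ, I γ) : ℝ :=
  ∑ c ∈ (tableCells o (C l)).filter
    (fun c => restr o (separator C l) c = restr o (separator C l) x), Real.exp (logWeight C η l c)

/-- The conditional table of the residual of a clique given the separator. -/
noncomputable def condTable (η : Idx G o → ℝ) (l : Fin k) (x : ∀ γ, I γ) : ℝ :=
  Real.exp (logWeight C η l x) / condNorm C η l x

/-- The joint table with the given log-odds of the residuals given the separators. -/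
noncomputable def jointTable (η : Idx G o → ℝ) (x : ∀ γ, I γ) : ℝ := ∏ l, condTable C η l x

variable {C}

omit [∀ γ, Fintype (I γ)] in
theorem dependsOn_logWeight (η : Idx G o → ℝ) (l : Fin k) :
    DependsOn (logWeight C η l) (C l : Set V) := by
  intro x y h
  rw [logWeight, logWeight, restr_congr h]

theorem dependsOn_condNorm (η : Idx G o → ℝ) (l : Fin k) :
    DependsOn (condNorm C η l) (separator C l : Set V) := by
  intro x y h
  rw [condNorm, condNorm, restr_congr (i := x) (j := y) h]

theorem dependsOn_condTable (η : Idx G o → ℝ) (l : Fin k) :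
    DependsOn (condTable C η l) (C l : Set V) := by
  intro x y h
  rw [condTable, condTable, dependsOn_logWeight η l h,
    dependsOn_condNorm η l fun γ hγ => h γ (separator_subset l hγ)]

theorem condNorm_pos (η : Idx G o → ℝ) (l : Fin k) (x : ∀ γ, I γ) : 0 < condNorm C η l x := by
  refine Finset.sum_pos (fun _ _ => Real.exp_pos _) ⟨restr o (separator C l) x, ?_⟩
  simp only [Finset.mem_filter, mem_tableCells, restr_restr, Finset.inter_self, and_true]
  exact (mem_tableCells.1 (restr_mem_tableCells _ _)).trans (separator_subset l)

theorem condTable_pos (η : Idx G o → ℝ) (l : Fin k) (x : ∀ γ, I γ) : 0 < condTable C η l x :=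
  div_pos (Real.exp_pos _) (condNorm_pos η l x)

theorem jointTable_pos (η : Idx G o → ℝ) (x : ∀ γ, I γ) : 0 < jointTable C η x :=
  Finset.prod_pos fun l _ => condTable_pos η l x

theorem log_condTable (η : Idx G o → ℝ) (l : Fin k) (x : ∀ γ, I γ) :
    Real.log (condTable C η l x) = logWeight C η l x - Real.log (condNorm C η l x) := by
  rw [condTable, Real.log_div (Real.exp_pos _).ne' (condNorm_pos η l x).ne', Real.log_exp]

theorem log_jointTable (η : Idx G o → ℝ) (x : ∀ γ, I γ) :
    Real.log (jointTable C η x) =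
      ∑ l, (logWeight C η l x - Real.log (condNorm C η l x)) := by
  rw [jointTable, Real.log_prod fun l _ => (condTable_pos η l x).ne']
  simp_rw [log_condTable]

theorem sum_condTable (η : Idx G o → ℝ) (l : Fin k) (y : ∀ γ, I γ) :
    ∑ c ∈ (tableCells o (C l)).filter
      (fun c => restr o (separator C l) c = restr o (separator C l) y), condTable C η l c = 1 := by
  have : ∀ c ∈ (tableCells o (C l)).filter
      (fun c => restr o (separator C l) c = restr o (separator C l) y),
      condTable C η l c = Real.exp (logWeight C η l c) / condNorm C η l y := by
    intro c hc
    rw [condTable, dependsOn_condNorm η l (restr_eq_restr.1 (Finset.mem_filter.1 hc).2)]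
  rw [Finset.sum_congr rfl this, ← Finset.sum_div]
  exact div_self (condNorm_pos η l y).ne'

theorem restr_block (β : Block o C) : restr o (separator C β.1) β.2.1 = β.2.1 :=
  restr_eq_self.2 (mem_tableCells.1 β.2.2)

theorem filter_eq_blockCells (β : Block o C) :
    (tableCells o (C β.1)).filter
      (fun c => restr o (separator C β.1) c = restr o (separator C β.1) β.2.1) = blockCells β := by
  rw [restr_block]
  rfl

theorem logWeight_base (η : Idx G o → ℝ) (β : Block o C) : logWeight C η β.1 β.2 = 0 := by
  have h := mem_tableCells.1 β.2.2
  rw [logWeight, restr_eq_self.2 (h.trans (separator_subset _)), if_pos h]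

theorem condNorm_of_mem_blockCells (η : Idx G o → ℝ) {β : Block o C} {c : ∀ γ, I γ}
    (hc : c ∈ blockCells β) : condNorm C η β.1 c = condNorm C η β.1 β.2 := by
  refine dependsOn_condNorm η β.1 (restr_eq_restr (o := o).1 ?_)
  rw [restr_block]
  exact (Finset.mem_filter.1 hc).2

variable (hC : IsPerfectOrdering G C)
include hC

theorem logWeight_block (η : Idx G o → ℝ) {β : Block o C} (j : {j : Idx G o // hC.block j = β}) :
    logWeight C η β.1 j.1.1 = η j.1 := by
  obtain ⟨j, rfl⟩ := j
  have h1 := hC.supp_subset_cliqueIdx j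
  have h2 := hC.not_supp_subset_separator j
  simp only [IsPerfectOrdering.block]
  rw [logWeight, restr_eq_self.2 h1, if_neg h2, val_coe]

theorem condNorm_block (η : Idx G o → ℝ) (β : Block o C) :
    condNorm C η β.1 β.2 = 1 + ∑ j : {j : Idx G o // hC.block j = β}, Real.exp (η j.1) := by
  rw [condNorm, filter_eq_blockCells, hC.sum_blockCells, logWeight_base, Real.exp_zero]
  simp_rw [logWeight_block hC]

theorem sum_jointTable (η : Idx G o → ℝ) : ∑ x, jointTable C η x = 1 :=
  sum_prod_eq_one (o := o) (dependsOn_condTable η) (sum_condTable η) hC.prevUnion_eq_univ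

theorem marg_clique_jointTable (η : Idx G o → ℝ) (l : Fin k) (c : ∀ γ, I γ) :
    marg (C l) (jointTable C η) c =
      condTable C η l c * marg (separator C l) (jointTable C η) c :=
  marg_clique_prod (dependsOn_condTable η) (sum_condTable η) hC.prevUnion_eq_univ l c

omit hC in
theorem marg_pos {p : (∀ γ, I γ) → ℝ} (hp : ∀ x, 0 < p x) (T : Finset V)
    (c : ∀ γ, I γ) : 0 < marg T p c :=
  Finset.sum_pos (fun _ _ => hp _) ⟨c, by simp⟩

end Conditionals

section ResidualLogOdds

variable {V : Type*} [Fintype V] [DecidableEq V] {I : V → Type*} [∀ γ, Fintype (I γ)]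
  [∀ γ, DecidableEq (I γ)] {o : ∀ γ, I γ} {G : SimpleGraph V} [DecidableRel G.Adj] {k : ℕ}
  {C : Fin k → Finset V}

section Regularity

omit [∀ γ, Fintype (I γ)] in
theorem differentiable_logWeight (l : Fin k) (x : ∀ γ, I γ) :
    Differentiable ℝ fun η : Idx G o → ℝ => logWeight C η l x := by
  unfold logWeight val
  split_ifs
  · exact differentiable_const _
  · exact differentiable_apply _
  · exact differentiable_const _

theorem differentiable_condNorm (l : Fin k) (x : ∀ γ, I γ) :
    Differentiable ℝ fun η : Idx G o → ℝ => condNorm C η l x := by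
  unfold condNorm
  exact Differentiable.fun_sum fun c _ => (differentiable_logWeight l c).exp

theorem differentiable_condTable (l : Fin k) (x : ∀ γ, I γ) :
    Differentiable ℝ fun η : Idx G o → ℝ => condTable C η l x := by
  unfold condTable
  simp_rw [div_eq_mul_inv]
  exact (differentiable_logWeight l x).exp.fun_mul
    ((differentiable_condNorm l x).fun_inv fun η => (condNorm_pos η l x).ne')

theorem differentiable_jointTable (x : ∀ γ, I γ) :
    Differentiable ℝ fun η : Idx G o → ℝ => jointTable C η x := by
  unfold jointTable
  exact fun η => (HasFDerivAt.finsetProd fun l _ =>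
    (differentiable_condTable l x η).hasFDerivAt).differentiableAt

theorem differentiable_marg_jointTable (T : Finset V) (c : ∀ γ, I γ) :
    Differentiable ℝ fun η : Idx G o → ℝ => marg T (jointTable C η) c := by
  unfold marg
  exact Differentiable.fun_sum fun x _ => differentiable_jointTable x

end Regularity

section Triangular

/-- The log-linear parameter of the joint table with log-odds `η` of the residuals. -/
noncomputable def logLinParam (C : Fin k → Finset V) (η : Idx G o → ℝ) (j : Idx G o) : ℝ :=
  moebius o (fun x => Real.log (jointTable C η x)) j.1

theorem measurable_logLinParam (j : Idx G o) :
    Measurable fun η : Idx G o → ℝ => logLinParam C η j := by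
  unfold logLinParam moebius
  exact Finset.measurable_sum _ fun c _ =>
    ((differentiable_jointTable c).continuous.measurable.log).const_mul _

variable (hC : IsPerfectOrdering G C)
include hC

omit [∀ γ, Fintype (I γ)] in
theorem logWeight_congr {η η' : Idx G o → ℝ} {l : Fin k}
    (h : ∀ i, hC.cliqueIdx i = l → η i = η' i) : logWeight C η l = logWeight C η' l := by
  funext x
  unfold logWeight val
  split_ifs with h1 h2
  · rfl
  · refine h _ (hC.cliqueIdx_eq ?_ h1)
    rw [supp_restr]
    exact Finset.inter_subset_left
  · rfl

theorem condTable_congr {η η' : Idx G o → ℝ} {l : Fin k}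
    (h : ∀ i, hC.cliqueIdx i = l → η i = η' i) : condTable C η l = condTable C η' l := by
  unfold condTable condNorm
  rw [logWeight_congr hC h]

omit [∀ γ, Fintype (I γ)] [DecidableRel G.Adj] in
theorem cliqueIdx_lt {j : Idx G o} {l : Fin k} (hl : l ≠ hC.cliqueIdx j)
    (hj : supp o j.1 ⊆ C l) : hC.cliqueIdx j < l := by
  by_contra h
  exact hC.not_supp_subset_separator j (Finset.subset_inter (hC.supp_subset_cliqueIdx j)
    (hj.trans (subset_prevUnion (lt_of_le_of_ne (not_lt.1 h) hl : l < hC.cliqueIdx j))))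

/-- The order in which the log-odds of the residuals determine the log-linear parameters. -/
noncomputable def interactionRank (j : Idx G o) : ℕ :=
  (hC.cliqueIdx j).val * (Fintype.card V + 1) + (Fintype.card V - (supp o j.1).card)

omit [∀ γ, Fintype (I γ)] [DecidableRel G.Adj] in
theorem interactionRank_lt_of_cliqueIdx_lt {j i : Idx G o} (h : hC.cliqueIdx j < hC.cliqueIdx i) :
    interactionRank hC j < interactionRank hC i := by
  have h1 : ((hC.cliqueIdx j).val + 1) * (Fintype.card V + 1) ≤
      (hC.cliqueIdx i).val * (Fintype.card V + 1) := Nat.mul_le_mul_right _ h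
  unfold interactionRank
  rw [Nat.add_mul] at h1
  omega

omit [∀ γ, Fintype (I γ)] [DecidableRel G.Adj] in
theorem interactionRank_lt_of_card_lt {j i : Idx G o} (h : hC.cliqueIdx j = hC.cliqueIdx i)
    (hc : (supp o i.1).card < (supp o j.1).card) :
    interactionRank hC j < interactionRank hC i := by
  have h1 : (supp o j.1).card ≤ Fintype.card V := Finset.card_le_univ _
  unfold interactionRank
  rw [h]
  omega

theorem dependsOn_logLinParam_sub (j : Idx G o) :
    DependsOn (fun η => logLinParam C η j - η j)
      {i | interactionRank hC j < interactionRank hC i} := by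
  intro η η' h
  have hexp : ∀ η : Idx G o → ℝ, logLinParam C η j =
      ∑ l, moebius o (fun x => logWeight C η l x - Real.log (condNorm C η l x)) j.1 := by
    intro η
    rw [logLinParam, ← moebius_sum]
    simp_rw [log_jointTable]
  simp only
  rw [hexp, hexp, ← Finset.add_sum_erase _ _ (Finset.mem_univ (hC.cliqueIdx j)),
    ← Finset.add_sum_erase _ _ (Finset.mem_univ (hC.cliqueIdx j)), add_sub_right_comm,
    add_sub_right_comm]
  congr 1
  · have hown : ∀ η : Idx G o → ℝ,
        moebius o (fun x => logWeight C η (hC.cliqueIdx j) x -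
          Real.log (condNorm C η (hC.cliqueIdx j) x)) j.1 - η j =
        ∑ c ∈ (Finset.univ.filter (Below o · j.1)).erase j.1,
          msign o c j.1 * logWeight C η (hC.cliqueIdx j) c := by
      intro η
      rw [moebius_sub, moebius_eq_zero (f := fun x => Real.log (condNorm C η (hC.cliqueIdx j) x))
        (fun x y hxy => by simp only [dependsOn_condNorm η _ hxy]) (hC.not_supp_subset_separator j),
        sub_zero, moebius, ← Finset.add_sum_erase _ _
          (show j.1 ∈ Finset.univ.filter (Below o · j.1) by simp [Below.refl]),
        msign_self, one_mul, show logWeight C η (hC.cliqueIdx j) j.1 = η j from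
          logWeight_block hC η (β := hC.block j) ⟨j, rfl⟩, add_sub_cancel_left]
    rw [hown η, hown η']
    refine Finset.sum_congr rfl fun c hc => ?_
    congr 1
    obtain ⟨hne, hc'⟩ := Finset.mem_erase.1 hc
    have hb : Below o c j.1 := (Finset.mem_filter.1 hc').2
    have hsub : supp o c ⊆ C (hC.cliqueIdx j) :=
      hb.supp_subset.trans (hC.supp_subset_cliqueIdx j)
    unfold logWeight val
    rw [restr_eq_self.2 hsub]
    split_ifs with h1 h2
    · rfl
    · refine h _ (interactionRank_lt_of_card_lt hC (hC.cliqueIdx_eq hsub h1).symm ?_)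
      by_contra hcard
      exact hne (hb.eq_of_card_le (not_lt.1 hcard))
    · rfl
  · refine Finset.sum_congr rfl fun l hl => ?_
    by_cases hj : supp o j.1 ⊆ C l
    · have hlt := cliqueIdx_lt hC (Finset.ne_of_mem_erase hl) hj
      have heq : logWeight C η l = logWeight C η' l := logWeight_congr hC fun i hi =>
        h i (interactionRank_lt_of_cliqueIdx_lt hC (hi ▸ hlt))
      unfold condNorm
      rw [heq]
    · have hd : ∀ η : Idx G o → ℝ, DependsOn
          (fun x => logWeight C η l x - Real.log (condNorm C η l x)) (C l : Set V) :=
        fun η x y hxy => by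
          simp only
          rw [dependsOn_logWeight η l hxy,
            dependsOn_condNorm η l fun γ hγ => hxy γ (separator_subset l hγ)]
      rw [moebius_eq_zero (hd η) hj, moebius_eq_zero (hd η') hj]

theorem measurePreserving_logLinParam :
    MeasurePreserving (fun η : Idx G o → ℝ => logLinParam C η) ∧
      Function.Bijective (fun η : Idx G o → ℝ => logLinParam C η) := by
  have := measurePreserving_triangular (interactionRank hC)
    (fun j η => logLinParam C η j - η j)
    (fun j => (measurable_logLinParam j).sub (measurable_pi_apply j))
    (dependsOn_logLinParam_sub (o := o) hC)
  simpa only [add_sub_cancel] using this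

theorem moebius_log_jointTable (η : Idx G o → ℝ) (j : ∀ γ, I γ) (hj : j ≠ o)
    (hj' : ¬ IsInteraction G (supp o j)) :
    moebius o (fun x => Real.log (jointTable C η x)) j = 0 := by
  simp_rw [log_jointTable]
  rw [moebius_sum]
  refine Finset.sum_eq_zero fun l _ => moebius_eq_zero (T := C l) (fun x y hxy => ?_) fun hs => ?_
  · rw [dependsOn_logWeight η l hxy,
      dependsOn_condNorm η l fun γ hγ => hxy γ (separator_subset l hγ)]
  · refine hj' ⟨?_, (hC.isClique l).subset (by exact_mod_cast hs)⟩
    rwa [Finset.nonempty_iff_ne_empty, Ne, supp_eq_empty]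

theorem sum_exp_log_jointTable (η : Idx G o → ℝ) :
    ∑ x, Real.exp (Real.log (jointTable C η x)) = 1 := by
  simp_rw [Real.exp_log (jointTable_pos η _)]
  exact sum_jointTable hC η

theorem cellProb_logLinParam (η : Idx G o → ℝ) :
    cellProb G o (logLinParam C η) = jointTable C η := by
  funext x
  rw [← Real.exp_log (jointTable_pos η x)]
  exact cellProb_moebius (moebius_log_jointTable hC η) (sum_exp_log_jointTable hC η) x

end Triangular

section Hyperparameters

variable (s : Idx G o → ℝ) (α : ℝ)

theorem sum_hyperParam {T T' : Finset V} (h : T' ⊆ T) {c : ∀ γ, I γ} (hc : c ∈ tableCells o T') :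
    ∑ i ∈ (tableCells o T).filter (fun i => restr o T' i = c), hyperParam G o s α T i =
      hyperParam G o s α T' c := by
  simp_rw [hyperParam_eq_inclExcl]
  exact sum_inclExcl _ h hc

theorem hyperParam_empty : hyperParam G o s α ∅ o = α := by
  rw [hyperParam_eq_inclExcl, inclExcl_empty, extend_base]

theorem sum_hyperParam_tableCells (T : Finset V) :
    ∑ c ∈ tableCells o T, hyperParam G o s α T c = α := by
  simp_rw [hyperParam_eq_inclExcl]
  rw [sum_inclExcl_tableCells, extend_base]

theorem isHyperconsistent_hyperParam (C : Fin k → Finset V) :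
    IsHyperconsistent o C (hyperParam G o s α) :=
  ⟨fun _ _ _ hc => (sum_hyperParam s α Finset.inter_subset_left hc).trans
    (sum_hyperParam s α Finset.inter_subset_right hc).symm,
    fun l _ _ hc => sum_hyperParam s α (separator_subset l) hc⟩

theorem sum_hyperParam_blockCells (β : Block o C) :
    ∑ c ∈ blockCells β, hyperParam G o s α (C β.1) c =
      hyperParam G o s α (separator C β.1) β.2 :=
  sum_hyperParam s α (separator_subset _) β.2.2

variable (hC : IsPerfectOrdering G C)
include hC

theorem hyperParam_separator (β : Block o C) :
    hyperParam G o s α (separator C β.1) β.2 = hyperParam G o s α (C β.1) β.2 +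
      ∑ j : {j : Idx G o // hC.block j = β}, hyperParam G o s α (C β.1) j.1.1 := by
  rw [← sum_hyperParam_blockCells, hC.sum_blockCells]

theorem priorKernel_logLinParam_eq_exp_sum (η : Idx G o → ℝ) :
    priorKernel G o s α (logLinParam C η) = Real.exp (∑ l, ∑ c ∈ tableCells o (C l),
      hyperParam G o s α (C l) c * Real.log (condTable C η l c)) := by
  have h := priorKernel_moebius (moebius_log_jointTable hC η) (sum_exp_log_jointTable hC η) s α
  refine h.trans (congrArg Real.exp ?_)
  simp_rw [log_jointTable, moebius_sum, Finset.sum_mul]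
  rw [Finset.sum_comm]
  refine Finset.sum_congr rfl fun l _ => ?_
  simp_rw [hyperParam_eq_inclExcl, ← log_condTable]
  exact (sum_inclExcl_mul _ fun x y hxy => by simp only [dependsOn_condTable η l hxy]).symm

/-- The kernel of the law of the conditional table in a block. -/
noncomputable def blockLogKernel (β : Block o C)
    (y : {j : Idx G o // hC.block j = β} → ℝ) : ℝ :=
  softmaxLogKernel (hyperParam G o s α (C β.1) β.2)
    (fun j : {j : Idx G o // hC.block j = β} => hyperParam G o s α (C β.1) j.1.1) y

theorem priorKernel_logLinParam (η : Idx G o → ℝ) :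
    priorKernel G o s α (logLinParam C η) =
      ∏ β : Block o C, Real.exp (blockLogKernel s α hC β fun j => η j.1) := by
  rw [priorKernel_logLinParam_eq_exp_sum s α hC, sum_tableCells_eq_sum_blockCells, Real.exp_sum]
  refine Finset.prod_congr rfl fun β _ => congrArg Real.exp ?_
  rw [blockLogKernel, softmaxLogKernel, ← condNorm_block hC, ← hyperParam_separator,
    ← sum_hyperParam_blockCells]
  have : ∀ c ∈ blockCells β, hyperParam G o s α (C β.1) c * Real.log (condTable C η β.1 c) =
      hyperParam G o s α (C β.1) c * logWeight C η β.1 c -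
        hyperParam G o s α (C β.1) c * Real.log (condNorm C η β.1 β.2) := by
    intro c hc
    rw [log_condTable, condNorm_of_mem_blockCells η hc, mul_sub]
  rw [Finset.sum_congr rfl this, Finset.sum_sub_distrib, ← Finset.sum_mul]
  congr 1
  rw [hC.sum_blockCells, logWeight_base, mul_zero, zero_add]
  simp_rw [logWeight_block hC]

theorem lintegral_priorKernel :
    ∫⁻ θ, ENNReal.ofReal (priorKernel G o s α θ) =
      ∏ β : Block o C, ∫⁻ y, ENNReal.ofReal (Real.exp (blockLogKernel s α hC β y)) := by
  have hmeas : Measurable fun θ => ENNReal.ofReal (priorKernel G o s α θ) := by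
    unfold priorKernel partitionFn logOdds
    have : ∀ j, Measurable fun θ : Idx G o → ℝ => val G o θ j := by
      intro j
      unfold val
      split_ifs <;> fun_prop
    fun_prop
  rw [← (measurePreserving_logLinParam hC).1.lintegral_comp hmeas,
    ← lintegral_prod_fibers hC.block
      (fun β y => ENNReal.ofReal (Real.exp (blockLogKernel s α hC β y)))
      fun β => (measurable_softmaxLogKernel _ _).exp.ennreal_ofReal]
  refine lintegral_congr fun η => ?_
  rw [priorKernel_logLinParam s α hC, ENNReal.ofReal_prod_of_nonneg fun _ _ => (Real.exp_pos _).le]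

omit hC [∀ γ, Fintype (I γ)] in
theorem priorKernel_pos [∀ γ, Fintype (I γ)] (θ : Idx G o → ℝ) : 0 < priorKernel G o s α θ :=
  Real.exp_pos _

variable {s α} (hα : 0 < α) (hproper : Integrable (priorKernel G o s α))
include hα hproper

theorem hyperParam_clique_pos (l : Fin k) :
    ∀ c ∈ tableCells o (C l), 0 < hyperParam G o s α (C l) c := by
  induction l using WellFoundedLT.induction with
  | ind l ih =>
    have hfin : ∀ β : Block o C,
        ∫⁻ y, ENNReal.ofReal (Real.exp (blockLogKernel s α hC β y)) ≠ ⊤ := by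
      intro β hβ
      have h1 := hproper.lintegral_lt_top
      rw [lintegral_priorKernel s α hC] at h1
      refine h1.ne ?_
      classical
      rw [← Finset.mul_prod_erase _ _ (Finset.mem_univ β), hβ, ENNReal.top_mul]
      exact Finset.prod_ne_zero_iff.2 fun β' _ => lintegral_softmax_ne_zero _ _
    have hsep : ∀ d ∈ tableCells o (separator C l),
        0 < hyperParam G o s α (separator C l) d := by
      intro d hd
      by_cases hl : l ∈ sepIdx k
      · obtain ⟨m, hm, hsub⟩ := hC.running_intersection l hl
        rw [← sum_hyperParam s α hsub hd]
        refine Finset.sum_pos (fun c hc => ih m hm c (Finset.mem_filter.1 hc).1) ⟨d, ?_⟩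
        have hd' := mem_tableCells.1 hd
        simpa using ⟨hd'.trans hsub, restr_eq_self.2 hd'⟩
      · rw [separator_eq_empty hl, tableCells_empty, Finset.mem_singleton] at hd
        rw [separator_eq_empty hl, hd, hyperParam_empty]
        exact hα
    intro c hc
    let β : Block o C := ⟨l, restr o (separator C l) c, restr_mem_tableCells _ _⟩
    have hA := hsep β.2 β.2.2
    rw [show hyperParam G o s α (separator C l) β.2 = _ from hyperParam_separator s α hC β] at hA
    obtain ⟨h0, h1⟩ := pos_of_lintegral_softmax_ne_top hA (hfin β)
    by_cases hcβ : c = β.2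
    · rw [hcβ]
      exact h0
    · have hcm : c ∈ blockCells β := Finset.mem_filter.2 ⟨hc, rfl⟩
      exact h1 ⟨⟨c, hC.isInteraction_of_mem_blockCells hcm hcβ⟩, hC.block_eq_iff.2 ⟨hcm, hcβ⟩⟩

theorem hyperParam_separator_pos (l : Fin k) :
    ∀ d ∈ tableCells o (separator C l), 0 < hyperParam G o s α (separator C l) d := by
  intro d hd
  rw [← sum_hyperParam s α (separator_subset l) hd]
  refine Finset.sum_pos (fun c hc => hyperParam_clique_pos hC hα hproper l c
    (Finset.mem_filter.1 hc).1) ⟨d, ?_⟩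
  have hd' := mem_tableCells.1 hd
  simpa using ⟨hd'.trans (separator_subset l), restr_eq_self.2 hd'⟩

theorem normConst_eq_prod : normConst G o s α =
    ∏ l, ((∏ c ∈ tableCells o (C l), Real.Gamma (hyperParam G o s α (C l) c)) /
      ∏ d ∈ tableCells o (separator C l), Real.Gamma (hyperParam G o s α (separator C l) d)) := by
  have hpos := hyperParam_clique_pos hC hα hproper
  have hmem : ∀ β : Block o C, ∀ c ∈ blockCells β, 0 < hyperParam G o s α (C β.1) c :=
    fun β c hc => hpos _ c (Finset.mem_filter.1 hc).1
  have h1 : ∀ β : Block o C, ∫⁻ y, ENNReal.ofReal (Real.exp (blockLogKernel s α hC β y)) =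
      ENNReal.ofReal ((∏ c ∈ blockCells β, Real.Gamma (hyperParam G o s α (C β.1) c)) /
        Real.Gamma (hyperParam G o s α (separator C β.1) β.2)) := by
    intro β
    have := lintegral_softmax (hmem β _ (mem_blockCells_self β))
      (a := fun j : {j : Idx G o // hC.block j = β} => hyperParam G o s α (C β.1) j.1.1)
      fun j => hmem β _ (hC.block_eq_iff.1 j.2).1
    rw [hC.prod_blockCells, hyperParam_separator s α hC]
    exact this
  rw [normConst, integral_eq_lintegral_of_nonneg_ae
    (Filter.Eventually.of_forall fun θ => (priorKernel_pos s α θ).le) hproper.aestronglyMeasurable,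
    lintegral_priorKernel s α hC, Finset.prod_congr rfl fun β _ => h1 β,
    ← ENNReal.ofReal_prod_of_nonneg, ENNReal.toReal_ofReal]
  · rw [Finset.prod_div_distrib, Finset.prod_div_distrib, ← prod_blocks,
      prod_tableCells_eq_prod_blockCells]
  · refine Finset.prod_nonneg fun β _ => div_nonneg (Finset.prod_nonneg fun c hc =>
      (Real.Gamma_pos_of_pos (hmem β c hc)).le) (Real.Gamma_pos_of_pos ?_).le
    exact hyperParam_separator_pos hC hα hproper _ _ β.2.2
  · refine fun β _ => div_nonneg (Finset.prod_nonneg fun c hc =>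
      (Real.Gamma_pos_of_pos (hmem β c hc)).le) (Real.Gamma_pos_of_pos ?_).le
    exact hyperParam_separator_pos hC hα hproper _ _ β.2.2

theorem normConst_eq : normConst G o s α =
    (∏ l, ∏ c ∈ tableCells o (C l), Real.Gamma (hyperParam G o s α (C l) c)) /
      (Real.Gamma α * ∏ l ∈ sepIdx k, ∏ c ∈ tableCells o (separator C l),
        Real.Gamma (hyperParam G o s α (separator C l) c)) := by
  rw [normConst_eq_prod hC hα hproper, Finset.prod_div_distrib]
  congr 1
  rw [prod_eq_mul_prod_sepIdx hC.pos, separator_eq_empty (l := ⟨0, hC.pos⟩) (by simp [sepIdx]),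
    tableCells_empty, Finset.prod_singleton, hyperParam_empty]

end Hyperparameters

end ResidualLogOdds

section FreeMarginals

variable {V : Type*} [Fintype V] [DecidableEq V] {I : V → Type*} [∀ γ, Fintype (I γ)]
  [∀ γ, DecidableEq (I γ)] {o : ∀ γ, I γ} {G : SimpleGraph V} [DecidableRel G.Adj] {k : ℕ}
  {C : Fin k → Finset V}

section Marginals

theorem marg_empty (p : (∀ γ, I γ) → ℝ) (c : ∀ γ, I γ) : marg ∅ p c = ∑ x, p x := by
  simp [marg]

theorem marg_congr (p : (∀ γ, I γ) → ℝ) {T : Finset V} {c c' : ∀ γ, I γ}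
    (h : ∀ γ ∈ T, c γ = c' γ) : marg T p c = marg T p c' := by
  unfold marg
  refine Finset.sum_congr (Finset.filter_congr fun x _ => ?_) fun _ _ => rfl
  exact forall₂_congr fun γ hγ => by rw [h γ hγ]

theorem marg_restr (p : (∀ γ, I γ) → ℝ) (T : Finset V) (c : ∀ γ, I γ) :
    marg T p (restr o T c) = marg T p c :=
  marg_congr p fun _ hγ => restr_apply_of_mem hγ c

theorem sum_marg (o : ∀ γ, I γ) (p : (∀ γ, I γ) → ℝ) {T T' : Finset V} (h : T' ⊆ T)
    (x : ∀ γ, I γ) :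
    ∑ c ∈ (tableCells o T).filter (fun c => restr o T' c = restr o T' x), marg T p c =
      marg T' p x := by
  rw [← marg_restr (o := o) p T' x, ← inclExcl_upperSum p (restr_mem_tableCells T' x),
    ← sum_inclExcl _ h (restr_mem_tableCells T' x)]
  exact Finset.sum_congr rfl fun c hc => (inclExcl_upperSum p (Finset.mem_filter.1 hc).1).symm

theorem upperSum_base (p : (∀ γ, I γ) → ℝ) : upperSum o p o = ∑ x, p x := by
  rw [upperSum, Finset.filter_true_of_mem fun x _ => below_base x]

/-- The family of free marginals read in the tables `R`, as a function of the upper sums of the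
table. -/
def freeOfUpper (R : Idx G o → Finset V) (m : Idx G o → ℝ) (j : Idx G o) : ℝ :=
  inclExcl o (extend G o m 1) (R j) j.1

variable {R : Idx G o → Finset V} (hR : ∀ j, supp o j.1 ⊆ R j)

include hR

theorem freeMarginals_eq (hR' : ∀ j, G.IsClique (R j : Set V)) {p : (∀ γ, I γ) → ℝ}
    (hp : ∑ x, p x = 1) :
    freeMarginals G o R p = freeOfUpper R fun j => upperSum o p j.1 := by
  funext j
  rw [freeMarginals, freeOfUpper, ← inclExcl_upperSum p (mem_tableCells.2 (hR j))]
  unfold inclExcl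
  refine Finset.sum_congr rfl fun i hi => ?_
  congr 1
  by_cases h : i = o
  · rw [h, extend_base, upperSum_base, hp]
  · have hint : IsInteraction G (supp o i) := by
      refine ⟨?_, (hR' j).subset ?_⟩
      · rwa [Finset.nonempty_iff_ne_empty, Ne, supp_eq_empty]
      · exact_mod_cast mem_tableCells.1 (Finset.mem_filter.1 hi).1
    rw [extend_of_ne _ _ h]
    exact (val_coe (fun j : Idx G o => upperSum o p j.1) ⟨i, hint⟩).symm

theorem measurePreserving_freeOfUpper :
    MeasurePreserving (freeOfUpper R : (Idx G o → ℝ) → Idx G o → ℝ) ∧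
      Function.Bijective (freeOfUpper R : (Idx G o → ℝ) → Idx G o → ℝ) := by
  have hmeas : ∀ i, Measurable fun m : Idx G o → ℝ => extend G o m 1 i := by
    intro i
    unfold extend val
    split_ifs <;> fun_prop
  have := measurePreserving_triangular (fun j : Idx G o => (supp o j.1).card)
    (fun j m => freeOfUpper R m j - m j) (fun j => by unfold freeOfUpper inclExcl; fun_prop) ?_
  · simpa only [add_sub_cancel] using this
  · intro j m m' h
    have hexp : ∀ m : Idx G o → ℝ, freeOfUpper R m j - m j =
        ∑ i ∈ ((tableCells o (R j)).filter (Below o j.1)).erase j.1,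
          msign o j.1 i * extend G o m 1 i := by
      intro m
      have hj : j.1 ∈ (tableCells o (R j)).filter (Below o j.1) := by
        simpa [Below.refl] using hR j
      have hjo : j.1 ≠ o := fun h => by
        have := j.2.1
        rw [h, supp_base] at this
        exact Finset.not_nonempty_empty this
      rw [freeOfUpper, inclExcl, ← Finset.add_sum_erase _ _ hj, msign_self, one_mul,
        extend_of_ne _ _ hjo, val_coe, add_sub_cancel_left]
    simp only
    rw [hexp m, hexp m']
    refine Finset.sum_congr rfl fun i hi => ?_
    congr 1
    obtain ⟨hne, hi'⟩ := Finset.mem_erase.1 hi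
    have hb : Below o j.1 i := (Finset.mem_filter.1 hi').2
    unfold extend val
    split_ifs with h1 h2
    · rfl
    · refine h _ (show (supp o j.1).card < (supp o i).card from ?_)
      by_contra hcard
      exact hne (hb.eq_of_card_le (not_lt.1 hcard)).symm
    · rfl

theorem volume_image_freeOfUpper (S : Set (Idx G o → ℝ)) :
    volume (freeOfUpper R '' S) = volume S := by
  obtain ⟨h1, h2⟩ := measurePreserving_freeOfUpper hR
  have := h1.measure_preimage_emb (h1.measurable.measurableEmbedding h2.1) (freeOfUpper R '' S)
  rw [← this, Set.preimage_image_eq _ h2.1]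

end Marginals

section MarkovTables

variable (hC : IsPerfectOrdering G C)
include hC

theorem condTable_block (η : Idx G o → ℝ) {β : Block o C}
    (j : {j : Idx G o // hC.block j = β}) : condTable C η β.1 j.1.1 =
      Real.exp (η j.1) / (1 + ∑ i : {j : Idx G o // hC.block j = β}, Real.exp (η i.1)) := by
  rw [condTable, logWeight_block hC, condNorm_of_mem_blockCells η (hC.block_eq_iff.1 j.2).1,
    condNorm_block hC]

theorem condTable_base (η : Idx G o → ℝ) (β : Block o C) : condTable C η β.1 β.2 =
    1 / (1 + ∑ i : {j : Idx G o // hC.block j = β}, Real.exp (η i.1)) := by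
  rw [condTable, logWeight_base, condNorm_block hC, Real.exp_zero]

omit [DecidableRel G.Adj] in
theorem prod_marg_separator {p : (∀ γ, I γ) → ℝ} (hp : ∑ x, p x = 1) (x : ∀ γ, I γ) :
    ∏ l, marg (separator C l) p x = ∏ l ∈ sepIdx k, marg (separator C l) p x := by
  rw [prod_eq_mul_prod_sepIdx hC.pos, separator_eq_empty (l := ⟨0, hC.pos⟩) (by simp [sepIdx]),
    marg_empty, hp, one_mul]

theorem jointTable_mem_markovTables (η : Idx G o → ℝ) : jointTable C η ∈ markovTables C := by
  refine ⟨jointTable_pos η, sum_jointTable hC η, fun x => ?_⟩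
  rw [← prod_marg_separator hC (sum_jointTable hC η), ← Finset.prod_div_distrib]
  refine Finset.prod_congr rfl fun l _ => ?_
  rw [marg_clique_jointTable hC, mul_div_cancel_right₀ _ (marg_pos (jointTable_pos η) _ _).ne']

/-- The Markov table with the given log-odds of the residuals given the separators. -/
noncomputable def markovTable (η : Idx G o → ℝ) : markovTables (I := I) C :=
  ⟨jointTable C η, jointTable_mem_markovTables hC η⟩

theorem markovTable_surjective :
    Function.Surjective (markovTable hC : (Idx G o → ℝ) → markovTables (I := I) C) := by
  rintro ⟨p, hpos, hsum, hp⟩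
  let η : Idx G o → ℝ := fun j => Real.log (marg (C (hC.cliqueIdx j)) p j.1 /
    marg (C (hC.cliqueIdx j)) p (restr o (separator C (hC.cliqueIdx j)) j.1))
  have hm := fun T c => marg_pos hpos T c
  have hw : ∀ l x, Real.exp (logWeight C η l x) =
      marg (C l) p x / marg (C l) p (restr o (separator C l) x) := by
    intro l x
    have hrr : restr o (separator C l) (restr o (C l) x) = restr o (separator C l) x := by
      rw [restr_restr, Finset.inter_eq_left.2 (separator_subset l)]
    by_cases h : supp o (restr o (C l) x) ⊆ separator C l
    · rw [logWeight, if_pos h, Real.exp_zero, ← marg_restr (o := o) p (C l) x, ← hrr,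
        restr_eq_self.2 h, div_self (hm _ _).ne']
    · have hint : IsInteraction G (supp o (restr o (C l) x)) := by
        refine ⟨?_, (hC.isClique l).subset ?_⟩
        · by_contra h0
          rw [Finset.not_nonempty_iff_eq_empty] at h0
          exact h (by simp [h0])
        · rw [supp_restr]
          exact_mod_cast Finset.inter_subset_left
      have hl : hC.cliqueIdx ⟨_, hint⟩ = l := hC.cliqueIdx_eq
        (by rw [supp_restr]; exact Finset.inter_subset_left) h
      rw [logWeight, if_neg h, val, dif_pos hint]
      simp only [η]
      rw [hl, hrr, marg_restr, Real.exp_log (div_pos (hm _ _) (hm _ _))]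
  have hcond : ∀ l x, condTable C η l x = marg (C l) p x / marg (separator C l) p x := by
    intro l x
    have hN : condNorm C η l x =
        marg (separator C l) p x / marg (C l) p (restr o (separator C l) x) := by
      rw [← sum_marg o p (separator_subset l) x, Finset.sum_div]
      refine Finset.sum_congr rfl fun c hc => ?_
      rw [hw, (Finset.mem_filter.1 hc).2]
    rw [condTable, hw, hN, div_div_div_cancel_right₀ (hm _ _).ne']
  refine ⟨η, Subtype.ext (funext fun x => ?_)⟩
  change ∏ l, condTable C η l x = p x
  simp_rw [hcond]
  rw [hp x, Finset.prod_div_distrib, prod_marg_separator hC hsum]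

theorem marg_clique_div (η : Idx G o → ℝ) (j : Idx G o) :
    marg (C (hC.cliqueIdx j)) (jointTable C η) j.1 /
      marg (C (hC.cliqueIdx j)) (jointTable C η) (restr o (separator C (hC.cliqueIdx j)) j.1) =
      Real.exp (η j) := by
  have h1 := condTable_block hC η (β := hC.block j) ⟨j, rfl⟩
  have h2 := condTable_base hC η (hC.block j)
  have hN := one_add_sum_exp_pos fun i : {i : Idx G o // hC.block i = hC.block j} => η i.1
  have hm := marg_pos (jointTable_pos (C := C) η) (separator C (hC.cliqueIdx j)) j.1
  simp only [IsPerfectOrdering.block] at h1 h2 hN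
  rw [marg_clique_jointTable hC, marg_clique_jointTable hC, marg_restr, h1, h2]
  field_simp

theorem upperSum_jointTable_injective :
    Function.Injective fun (η : Idx G o → ℝ) (j : Idx G o) => upperSum o (jointTable C η) j.1 := by
  intro η η' h
  have hu : ∀ l, ∀ c ∈ tableCells o (C l),
      marg (C l) (jointTable C η) c = marg (C l) (jointTable C η') c := by
    intro l c hc
    rw [← inclExcl_upperSum _ hc, ← inclExcl_upperSum _ hc]
    unfold inclExcl
    refine Finset.sum_congr rfl fun i hi => ?_
    congr 1
    by_cases h0 : i = o
    · rw [h0, upperSum_base, upperSum_base, sum_jointTable hC, sum_jointTable hC]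
    · have hint : IsInteraction G (supp o i) := by
        refine ⟨?_, (hC.isClique l).subset ?_⟩
        · rwa [Finset.nonempty_iff_ne_empty, Ne, supp_eq_empty]
        · exact_mod_cast mem_tableCells.1 (Finset.mem_filter.1 hi).1
      exact congrFun h ⟨i, hint⟩
  funext j
  refine Real.exp_injective ?_
  rw [← marg_clique_div hC, ← marg_clique_div hC,
    hu _ _ (mem_tableCells.2 (hC.supp_subset_cliqueIdx j)), hu]
  rw [mem_tableCells, supp_restr]
  exact Finset.inter_subset_left.trans (separator_subset _)

variable {R : Idx G o → Finset V}

omit hC [∀ γ, Fintype (I γ)] [DecidableRel G.Adj] in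
theorem IsFreeChoice.isClique (hC : IsPerfectOrdering G C) (hR : IsFreeChoice G o C R)
    (j : Idx G o) : G.IsClique (R j : Set V) := by
  rcases (hR j).2 with ⟨l, -, h⟩ | ⟨-, l, h⟩
  · rw [h]
    exact (hC.isClique l).subset (by exact_mod_cast separator_subset l)
  · rw [h]
    exact hC.isClique l

variable (hR : ∀ j, supp o j.1 ⊆ R j) (hR' : ∀ j, G.IsClique (R j : Set V))
include hR hR'

theorem freeMarginals_jointTable (η : Idx G o → ℝ) : freeMarginals G o R (jointTable C η) =
    freeOfUpper R fun j => upperSum o (jointTable C η) j.1 :=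
  freeMarginals_eq hR hR' (sum_jointTable hC η)

theorem freeMarginals_jointTable_injective :
    Function.Injective fun η : Idx G o → ℝ => freeMarginals G o R (jointTable C η) := by
  simp_rw [freeMarginals_jointTable hC hR hR']
  exact (measurePreserving_freeOfUpper hR).2.1.comp (upperSum_jointTable_injective hC)

theorem volume_image_freeMarginals (S : Set (Idx G o → ℝ)) :
    volume ((fun η => freeMarginals G o R (jointTable C η)) '' S) =
      volume ((fun (η : Idx G o → ℝ) (j : Idx G o) => upperSum o (jointTable C η) j.1) '' S) := by
  simp_rw [freeMarginals_jointTable hC hR hR']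
  rw [← volume_image_freeOfUpper hR
    ((fun (η : Idx G o → ℝ) (j : Idx G o) => upperSum o (jointTable C η) j.1) '' S),
    Set.image_image]

end MarkovTables

end FreeMarginals

section ChangeOfVariables

variable {V : Type*} [Fintype V] [DecidableEq V] {I : V → Type*} [∀ γ, Fintype (I γ)]
  [∀ γ, DecidableEq (I γ)] {o : ∀ γ, I γ} {G : SimpleGraph V} [DecidableRel G.Adj] {k : ℕ}
  {C : Fin k → Finset V} (hC : IsPerfectOrdering G C)
include hC

section Jacobian

/-- The marginals of a table, each read in the table of the clique that introduces it. -/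
noncomputable def cliqueMarginals (η : Idx G o → ℝ) : Idx G o → ℝ :=
  freeMarginals G o (fun j => C (hC.cliqueIdx j)) (jointTable C η)

theorem cliqueMarginals_apply (η : Idx G o → ℝ) (j : Idx G o) : cliqueMarginals hC η j =
    condTable C η (hC.cliqueIdx j) j.1 *
      marg (separator C (hC.cliqueIdx j)) (jointTable C η) j.1 :=
  marg_clique_jointTable hC η _ _

theorem differentiable_cliqueMarginals :
    Differentiable ℝ (cliqueMarginals hC : (Idx G o → ℝ) → Idx G o → ℝ) :=
  differentiable_pi.2 fun _ => differentiable_marg_jointTable _ _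

theorem marg_separator_congr {η η' : Idx G o → ℝ} {l : Fin k}
    (h : ∀ i, hC.cliqueIdx i < l → η i = η' i) (c : ∀ γ, I γ) :
    marg (separator C l) (jointTable C η) c = marg (separator C l) (jointTable C η') c := by
  have hs : separator C l ⊆ prevUnion C l.val := Finset.inter_subset_right
  have hm : ∀ η : Idx G o → ℝ, marg (separator C l) (jointTable C η) c = _ := fun η =>
    marg_prod (o := o) (dependsOn_condTable η) (sum_condTable η) hC.prevUnion_eq_univ l.isLt.le hs c
  rw [hm, hm]
  refine Finset.sum_congr rfl fun x _ => ?_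
  congr 1
  refine Finset.prod_congr rfl fun m hm => ?_
  rw [condTable_congr hC fun i hi => h i (by rw [hi]; exact (Finset.mem_filter.1 hm).2)]

theorem condTable_congr_block {η η' : Idx G o → ℝ} (j : Idx G o)
    (h : ∀ i, hC.block i = hC.block j → η i = η' i) :
    condTable C η (hC.cliqueIdx j) j.1 = condTable C η' (hC.cliqueIdx j) j.1 := by
  have h1 : ∀ η : Idx G o → ℝ, condTable C η (hC.cliqueIdx j) j.1 = _ := fun η =>
    condTable_block hC η (β := hC.block j) ⟨j, rfl⟩
  rw [h1, h1]
  simp only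
  rw [h j rfl, Finset.sum_congr rfl fun i _ => by rw [h i.1 i.2]]

theorem hasDerivAt_cliqueMarginals (η : Idx G o → ℝ) (i j : Idx G o) :
    HasDerivAt (fun t : ℝ => cliqueMarginals hC (η + t • Pi.single i 1) j)
      (fderiv ℝ (cliqueMarginals hC) η (Pi.single i 1) j) 0 := by
  have h1 : HasFDerivAt (cliqueMarginals hC) (fderiv ℝ (cliqueMarginals hC) η)
      (η + (0 : ℝ) • Pi.single i (1 : ℝ)) := by
    rw [zero_smul, add_zero]
    exact (differentiable_cliqueMarginals hC η).hasFDerivAt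
  have h2 : HasDerivAt (fun t : ℝ => η + t • (Pi.single i 1 : Idx G o → ℝ)) (Pi.single i 1) 0 := by
    simpa using ((hasDerivAt_id (0 : ℝ)).smul_const (Pi.single i 1 : Idx G o → ℝ)).const_add η
  exact hasDerivAt_pi.1 (h1.comp_hasDerivAt (0 : ℝ) h2) j

theorem fderiv_cliqueMarginals_of_block_ne (η : Idx G o → ℝ) {i j : Idx G o}
    (hne : hC.block j ≠ hC.block i) (hle : hC.cliqueIdx j ≤ hC.cliqueIdx i) :
    fderiv ℝ (cliqueMarginals hC) η (Pi.single i 1) j = 0 := by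
  refine (hasDerivAt_cliqueMarginals hC η i j).unique ?_
  have : (fun t : ℝ => cliqueMarginals hC (η + t • Pi.single i 1) j) =
      fun _ => cliqueMarginals hC η j := by
    funext t
    rw [cliqueMarginals_apply, cliqueMarginals_apply]
    congr 1
    · refine condTable_congr_block hC j fun i' hi' => ?_
      have : i' ≠ i := fun h => hne (by rw [← hi', h])
      simp [this]
    · refine marg_separator_congr hC (fun i' hi' => ?_) _
      have : i' ≠ i := fun h => absurd (h ▸ hi') (not_lt.2 hle)
      simp [this]
  rw [this]
  exact hasDerivAt_const _ _

theorem fderiv_cliqueMarginals_of_block_eq (η : Idx G o → ℝ) {β : Block o C}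
    (i j : {j : Idx G o // hC.block j = β}) :
    fderiv ℝ (cliqueMarginals hC) η (Pi.single i.1 1) j.1 =
      marg (separator C β.1) (jointTable C η) β.2 * (condTable C η β.1 j.1.1 *
        ((if j = i then 1 else 0) - condTable C η β.1 i.1.1)) := by
  refine (hasDerivAt_cliqueMarginals hC η i.1 j.1).unique ?_
  have hval : ∀ (t : ℝ) (r : {j : Idx G o // hC.block j = β}),
      (η + t • (Pi.single i.1 1 : Idx G o → ℝ)) r.1 = η r.1 + t * if r = i then 1 else 0 := by
    intro t r
    by_cases h : r = i
    · subst h; simp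
    · have : r.1 ≠ i.1 := fun h' => h (Subtype.ext h')
      simp [h, this]
  have hfun : (fun t : ℝ => cliqueMarginals hC (η + t • Pi.single i.1 1) j.1) = fun t : ℝ =>
      Real.exp (η j.1 + t * if j = i then 1 else 0) /
        (1 + ∑ r : {j : Idx G o // hC.block j = β},
          Real.exp (η r.1 + t * if r = i then 1 else 0)) *
        marg (separator C β.1) (jointTable C η) β.2 := by
    funext t
    have hj : hC.cliqueIdx j.1 = β.1 := congrArg Sigma.fst j.2
    rw [cliqueMarginals_apply, hj, condTable_block hC _ j]
    simp_rw [hval]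
    congr 1
    rw [marg_separator_congr hC (η' := η) fun i' hi' => ?_]
    · refine marg_congr _ (restr_eq_restr (o := o).1 ?_)
      rw [restr_block]
      exact (Finset.mem_filter.1 (hC.block_eq_iff.1 j.2).1).2
    · have : i' ≠ i.1 := fun h => by
        rw [h, show hC.cliqueIdx i.1 = β.1 from congrArg Sigma.fst i.2] at hi'
        exact lt_irrefl _ hi'
      simp [this]
  rw [hfun]
  have hexp : ∀ r : {j : Idx G o // hC.block j = β},
      HasDerivAt (fun t : ℝ => Real.exp (η r.1 + t * if r = i then 1 else 0))
        (Real.exp (η r.1) * if r = i then 1 else 0) 0 := by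
    intro r
    have := (((hasDerivAt_id (0 : ℝ)).mul_const (if r = i then (1 : ℝ) else 0)).const_add
      (η r.1)).exp
    simpa using this
  have hden : HasDerivAt (fun t : ℝ => 1 + ∑ r : {j : Idx G o // hC.block j = β},
      Real.exp (η r.1 + t * if r = i then 1 else 0))
      (∑ r : {j : Idx G o // hC.block j = β}, Real.exp (η r.1) * if r = i then 1 else 0) 0 :=
    (HasDerivAt.fun_sum fun r _ => hexp r).const_add 1
  have hN := one_add_sum_exp_pos fun r : {j : Idx G o // hC.block j = β} => η r.1
  have h := ((hexp j).fun_div hden (by simpa using hN.ne')).mul_const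
    (marg (separator C β.1) (jointTable C η) β.2)
  refine h.congr_deriv ?_
  rw [condTable_block hC η j, condTable_block hC η i]
  simp only [zero_mul, add_zero]
  simp only [mul_ite, mul_one, mul_zero, Finset.sum_ite_eq', Finset.mem_univ,
    if_true]
  split_ifs
  · field_simp
  · field_simp
    ring

/-- The Jacobian determinant of the free marginals with respect to the log-odds of the residuals
given the separators. -/
noncomputable def jacobian (p : (∀ γ, I γ) → ℝ) (o : ∀ γ, I γ) (C : Fin k → Finset V) : ℝ :=
  ∏ l, ((∏ c ∈ tableCells o (C l), marg (C l) p c) /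
    ∏ d ∈ tableCells o (separator C l), marg (separator C l) p d)

theorem det_fderiv_cliqueMarginals (η : Idx G o → ℝ) :
    (fderiv ℝ (cliqueMarginals hC) η).det = jacobian (jointTable C η) o C := by
  rw [ContinuousLinearMap.det, ← LinearMap.det_toMatrix']
  rw [det_eq_prod_blocks _ hC.block (fun β => β.1.val)]
  · rw [jacobian, Finset.prod_div_distrib, ← prod_blocks, prod_tableCells_eq_prod_blockCells,
      ← Finset.prod_div_distrib]
    refine Finset.prod_congr rfl fun β _ => ?_
    have hM : (Matrix.of fun i j : {j : Idx G o // hC.block j = β} =>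
        LinearMap.toMatrix' (fderiv ℝ (cliqueMarginals hC) η : (Idx G o → ℝ) →ₗ[ℝ] Idx G o → ℝ)
          i.1 j.1) = Matrix.of fun i j : {j : Idx G o // hC.block j = β} =>
        marg (separator C β.1) (jointTable C η) β.2 * (condTable C η β.1 i.1.1 *
          ((if i = j then 1 else 0) - condTable C η β.1 j.1.1)) := by
      ext i j
      rw [Matrix.of_apply, Matrix.of_apply, LinearMap.toMatrix'_apply,
        ← fderiv_cliqueMarginals_of_block_eq hC η j i]
      rfl
    have hN := one_add_sum_exp_pos fun r : {j : Idx G o // hC.block j = β} => η r.1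
    have hS := marg_pos (jointTable_pos (C := C) η) (separator C β.1) β.2
    have hbase : 1 - ∑ i : {j : Idx G o // hC.block j = β}, condTable C η β.1 i.1.1 =
        condTable C η β.1 β.2 := by
      simp_rw [condTable_block hC, condTable_base hC]
      rw [← Finset.sum_div]
      field_simp
      ring
    rw [hM, det_scaled_covariance, hbase, hC.prod_blockCells, marg_clique_jointTable hC, mul_div_right_comm,
      mul_div_cancel_right₀ _ hS.ne', mul_comm]
    congr 1
    refine Finset.prod_congr rfl fun j _ => ?_
    rw [marg_clique_jointTable hC, mul_comm]
    congr 1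
    refine marg_congr _ (restr_eq_restr (o := o).1 ?_)
    rw [restr_block]
    exact (Finset.mem_filter.1 (hC.block_eq_iff.1 j.2).1).2.symm
  · intro i j hne hle
    rw [LinearMap.toMatrix'_apply]
    exact fderiv_cliqueMarginals_of_block_ne hC η hne hle

omit hC in
theorem jacobian_pos {p : (∀ γ, I γ) → ℝ} (hp : ∀ x, 0 < p x) : 0 < jacobian p o C :=
  Finset.prod_pos fun _ _ => div_pos (Finset.prod_pos fun _ _ => marg_pos hp _ _)
    (Finset.prod_pos fun _ _ => marg_pos hp _ _)

end Jacobian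

section Law

theorem measurable_markovTable :
    Measurable (markovTable hC : (Idx G o → ℝ) → markovTables (I := I) C) :=
  Measurable.subtype_mk (measurable_pi_iff.2 fun x =>
    (differentiable_jointTable x).continuous.measurable)

variable {R : Idx G o → Finset V} (hR : ∀ j, supp o j.1 ⊆ R j)
  (hR' : ∀ j, G.IsClique (R j : Set V))
include hR hR'

theorem comap_freeMarginals :
    (volume : Measure (Idx G o → ℝ)).comap
      (fun p : markovTables (I := I) C => freeMarginals G o R p.1) =
    (volume.withDensity fun η : Idx G o → ℝ =>
      ENNReal.ofReal (jacobian (jointTable C η) o C)).map (markovTable hC) := by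
  have hinj : Function.Injective
      (fun p : markovTables (I := I) C => freeMarginals G o R p.1) := by
    intro p p' h
    obtain ⟨η, rfl⟩ := markovTable_surjective (o := o) hC p
    obtain ⟨η', rfl⟩ := markovTable_surjective (o := o) hC p'
    rw [freeMarginals_jointTable_injective hC hR hR' h]
  have himage : ∀ B : Set (markovTables (I := I) C),
      (fun p : markovTables (I := I) C => freeMarginals G o R p.1) '' B =
      (fun η : Idx G o → ℝ => freeMarginals G o R (jointTable C η)) '' (markovTable (o := o) hC ⁻¹' B) := by
    intro B
    conv_lhs => rw [← Set.image_preimage_eq B (markovTable_surjective (o := o) hC), Set.image_image]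
    rfl
  have hmeas : Measurable fun η : Idx G o → ℝ => freeMarginals G o R (jointTable C η) :=
    measurable_pi_iff.2 fun j => (differentiable_marg_jointTable _ _).continuous.measurable
  have hD : ∀ j : Idx G o, supp o j.1 ⊆ C (hC.cliqueIdx j) := hC.supp_subset_cliqueIdx
  have hD' : ∀ j : Idx G o, G.IsClique (C (hC.cliqueIdx j) : Set V) := fun j => hC.isClique _
  ext B hB
  have hB' := measurable_markovTable (o := o) hC hB
  rw [Measure.comap_apply _ hinj (fun B hB => ?_) _ hB, himage,
    volume_image_freeMarginals hC hR hR', ← volume_image_freeMarginals hC hD hD',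
    Measure.map_apply (measurable_markovTable hC) hB, withDensity_apply _ hB']
  · have hdet := lintegral_abs_det_fderiv_eq_addHaar_image volume hB'
      (fun η _ => (differentiable_cliqueMarginals hC η).hasFDerivAt.hasFDerivWithinAt)
      (freeMarginals_jointTable_injective hC hD hD').injOn
    refine hdet.symm.trans (lintegral_congr fun η => ?_)
    rw [det_fderiv_cliqueMarginals, abs_of_pos (jacobian_pos (jointTable_pos η))]
  · rw [himage]
    exact (measurable_markovTable hC hB).image_of_measurable_injOn hmeas
      (freeMarginals_jointTable_injective hC hR hR').injOn

end Law

end ChangeOfVariables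

section Density

variable {V : Type*} [Fintype V] [DecidableEq V] {I : V → Type*} [∀ γ, Fintype (I γ)]
  [∀ γ, DecidableEq (I γ)] {o : ∀ γ, I γ} {G : SimpleGraph V} [DecidableRel G.Adj] {k : ℕ}
  {C : Fin k → Finset V} (hC : IsPerfectOrdering G C) (s : Idx G o → ℝ) (α : ℝ)

theorem dirichletDensity_hyperParam (T : Finset V) {x : (∀ γ, I γ) → ℝ} (hx : ∀ c, 0 < x c) :
    dirichletDensity o T (hyperParam G o s α T) x =
      Real.Gamma α / (∏ c ∈ tableCells o T, Real.Gamma (hyperParam G o s α T c)) *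
        ((∏ c ∈ tableCells o T, x c ^ hyperParam G o s α T c) / ∏ c ∈ tableCells o T, x c) := by
  rw [dirichletDensity, sum_hyperParam_tableCells, ← Finset.prod_div_distrib]
  congr 1
  exact Finset.prod_congr rfl fun c _ => Real.rpow_sub_one (hx c).ne' _

include hC

theorem prod_marg_rpow (η : Idx G o → ℝ) (l : Fin k) :
    ∏ c ∈ tableCells o (C l), marg (C l) (jointTable C η) c ^ hyperParam G o s α (C l) c =
      (∏ c ∈ tableCells o (C l), condTable C η l c ^ hyperParam G o s α (C l) c) *
        ∏ d ∈ tableCells o (separator C l),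
          marg (separator C l) (jointTable C η) d ^ hyperParam G o s α (separator C l) d := by
  have hm := fun T c => marg_pos (jointTable_pos (C := C) η) T c
  have h1 : ∏ d ∈ tableCells o (separator C l),
      marg (separator C l) (jointTable C η) d ^ hyperParam G o s α (separator C l) d =
      ∏ c ∈ tableCells o (C l),
        marg (separator C l) (jointTable C η) c ^ hyperParam G o s α (C l) c := by
    rw [← Finset.prod_fiberwise_of_maps_to (s := tableCells o (C l)) (t := tableCells o (separator C l))
      (g := restr o (separator C l)) fun c _ => restr_mem_tableCells _ c]
    refine Finset.prod_congr rfl fun d hd => ?_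
    rw [← sum_hyperParam s α (separator_subset l) hd, Real.rpow_sum_of_pos (hm _ _)]
    refine Finset.prod_congr rfl fun c hc => ?_
    rw [← (Finset.mem_filter.1 hc).2, marg_restr]
  rw [h1, ← Finset.prod_mul_distrib]
  refine Finset.prod_congr rfl fun c _ => ?_
  rw [marg_clique_jointTable hC, Real.mul_rpow (condTable_pos η l c).le (hm _ _).le]

theorem priorKernel_logLinParam_eq_prod (η : Idx G o → ℝ) :
    priorKernel G o s α (logLinParam C η) =
      ∏ l, ∏ c ∈ tableCells o (C l), condTable C η l c ^ hyperParam G o s α (C l) c := by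
  rw [priorKernel_logLinParam_eq_exp_sum s α hC, Real.exp_sum]
  refine Finset.prod_congr rfl fun l _ => ?_
  rw [Real.exp_sum]
  refine Finset.prod_congr rfl fun c _ => ?_
  rw [Real.rpow_def_of_pos (condTable_pos η l c), mul_comm]

variable {s α} (hα : 0 < α)

include hα

theorem hyperDirichletDensity_jointTable (η : Idx G o → ℝ) :
    hyperDirichletDensity o C (hyperParam G o s α) (jointTable C η) =
      ∏ l, (dirichletDensity o (C l) (hyperParam G o s α (C l)) (marg (C l) (jointTable C η)) /
        dirichletDensity o (separator C l) (hyperParam G o s α (separator C l))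
          (marg (separator C l) (jointTable C η))) := by
  rw [hyperDirichletDensity, Finset.prod_div_distrib]
  congr 1
  rw [prod_eq_mul_prod_sepIdx hC.pos, separator_eq_empty (l := ⟨0, hC.pos⟩) (by simp [sepIdx]),
    dirichletDensity, tableCells_empty, Finset.prod_singleton, Finset.sum_singleton,
    Finset.prod_singleton, hyperParam_empty, marg_empty, sum_jointTable hC, Real.one_rpow,
    div_self (Real.Gamma_pos_of_pos hα).ne', one_mul, one_mul]

variable (hproper : Integrable (priorKernel G o s α))
include hproper

theorem jacobian_mul_hyperDirichletDensity (η : Idx G o → ℝ) :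
    jacobian (jointTable C η) o C *
        hyperDirichletDensity o C (hyperParam G o s α) (jointTable C η) =
      (normConst G o s α)⁻¹ * priorKernel G o s α (logLinParam C η) := by
  rw [hyperDirichletDensity_jointTable hC hα, normConst_eq_prod hC hα hproper,
    priorKernel_logLinParam_eq_prod hC, jacobian, ← Finset.prod_inv_distrib,
    ← Finset.prod_mul_distrib, ← Finset.prod_mul_distrib]
  refine Finset.prod_congr rfl fun l _ => ?_
  have hm := fun T c => marg_pos (jointTable_pos (C := C) η) T c
  rw [dirichletDensity_hyperParam _ _ _ (hm _), dirichletDensity_hyperParam _ _ _ (hm _),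
    prod_marg_rpow hC]
  have h0 := (Real.Gamma_pos_of_pos hα).ne'
  have h1 : ∏ c ∈ tableCells o (C l), Real.Gamma (hyperParam G o s α (C l) c) ≠ 0 :=
    Finset.prod_ne_zero_iff.2 fun c hc =>
      (Real.Gamma_pos_of_pos (hyperParam_clique_pos hC hα hproper l c hc)).ne'
  have h2 : ∏ d ∈ tableCells o (separator C l),
      Real.Gamma (hyperParam G o s α (separator C l) d) ≠ 0 :=
    Finset.prod_ne_zero_iff.2 fun d hd =>
      (Real.Gamma_pos_of_pos (hyperParam_separator_pos hC hα hproper l d hd)).ne'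
  have h3 : ∏ c ∈ tableCells o (C l), marg (C l) (jointTable C η) c ≠ 0 :=
    Finset.prod_ne_zero_iff.2 fun c _ => (hm _ c).ne'
  have h4 : ∏ d ∈ tableCells o (separator C l), marg (separator C l) (jointTable C η) d ≠ 0 :=
    Finset.prod_ne_zero_iff.2 fun d _ => (hm _ d).ne'
  have h5 : ∏ d ∈ tableCells o (separator C l), marg (separator C l) (jointTable C η) d ^
      hyperParam G o s α (separator C l) d ≠ 0 :=
    Finset.prod_ne_zero_iff.2 fun d _ => (Real.rpow_pos_of_pos (hm _ d) _).ne'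
  field_simp

theorem map_cellProb_prior {R : Idx G o → Finset V} (hR : IsFreeChoice G o C R) :
    (prior G o s α).map (cellProb G o) = hyperDirichlet G o C R (hyperParam G o s α) := by
  have hval : ∀ j, Measurable fun θ : Idx G o → ℝ => val G o θ j := by
    intro j
    unfold val
    split_ifs <;> fun_prop
  have hcell : Measurable (cellProb G o : (Idx G o → ℝ) → (∀ γ, I γ) → ℝ) := by
    refine measurable_pi_iff.2 fun x => ?_
    unfold cellProb partitionFn logOdds
    fun_prop
  have hdens : Measurable fun θ : Idx G o → ℝ =>
      ENNReal.ofReal ((normConst G o s α)⁻¹ * priorKernel G o s α θ) := by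
    unfold priorKernel partitionFn logOdds
    fun_prop
  have hhyper : Measurable fun p : markovTables (I := I) C =>
      ENNReal.ofReal (hyperDirichletDensity o C (hyperParam G o s α) p.1) := by
    unfold hyperDirichletDensity dirichletDensity marg
    fun_prop
  have hjac : Measurable fun η : Idx G o → ℝ =>
      ENNReal.ofReal (jacobian (jointTable C η) o C) := by
    have := fun T c =>
      (differentiable_marg_jointTable (o := o) (G := G) (C := C) T c).continuous.measurable
    unfold jacobian
    fun_prop
  have hΘ := (measurePreserving_logLinParam (o := o) hC).1
  have hM := measurable_markovTable (o := o) hC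
  rw [prior, hyperDirichlet, comap_freeMarginals hC (fun j => (hR j).1) (hR.isClique hC),
    withDensity_map _ hM hhyper, ← hΘ.map_eq, withDensity_map _ hΘ.measurable hdens,
    Measure.map_map hcell hΘ.measurable, Measure.map_map measurable_subtype_coe hM, hΘ.map_eq]
  refine Eq.trans ?_ (congrArg (Measure.map _) (withDensity_mul volume hjac (hhyper.comp hM)))
  have hcomp : (cellProb G o ∘ fun η : Idx G o → ℝ => logLinParam C η) =
      Subtype.val ∘ markovTable hC := funext fun η => cellProb_logLinParam hC η
  rw [hcomp]
  congr 2
  funext η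
  rw [Pi.mul_apply, ← ENNReal.ofReal_mul (jacobian_pos (jointTable_pos η)).le]
  exact congrArg _ (jacobian_mul_hyperDirichletDensity hC hα hproper η).symm

end Density

end LogLinear

open LogLinear in
theorem proposition4p1 {V : Type*} [Fintype V] [DecidableEq V]
    {I : V → Type*} [∀ γ, Fintype (I γ)] [∀ γ, DecidableEq (I γ)] (o : ∀ γ, I γ)
    (G : SimpleGraph V) [DecidableRel G.Adj]
    {k : ℕ} (C : Fin k → Finset V) (hC : IsPerfectOrdering G C)
    (s : Idx G o → ℝ) (α : ℝ) (hα : 0 < α)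
    (hproper : MeasureTheory.Integrable (priorKernel G o s α)) :
    ((∀ l, ∀ c ∈ tableCells o (C l), 0 < hyperParam G o s α (C l) c) ∧
      (∀ l ∈ sepIdx k, ∀ c ∈ tableCells o (separator C l),
        0 < hyperParam G o s α (separator C l) c) ∧
      IsHyperconsistent o C (hyperParam G o s α)) ∧
    (∀ R : Idx G o → Finset V, IsFreeChoice G o C R →
      (prior G o s α).map (cellProb G o) = hyperDirichlet G o C R (hyperParam G o s α)) ∧
    normConst G o s α =
      (∏ l, ∏ c ∈ tableCells o (C l), Real.Gamma (hyperParam G o s α (C l) c)) /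
        (Real.Gamma α * ∏ l ∈ sepIdx k, ∏ c ∈ tableCells o (separator C l),
          Real.Gamma (hyperParam G o s α (separator C l) c)) :=
  ⟨⟨hyperParam_clique_pos hC hα hproper,
      fun l _ => hyperParam_separator_pos hC hα hproper l, isHyperconsistent_hyperParam s α C⟩,
    fun _ hR => map_cellProb_prior hC hα hproper hR, normConst_eq hC hα hproper⟩
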